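/- Let $(M,I)$ be a smooth almost complex manifold, $E\to M$ a smooth real vector bundle of finite even rank, and $\nabla$ a smooth connection on $E$ with curvature $R(v,w)=\nabla_v\nabla_w-\nabla_w\nabla_v-\nabla_{[v,w]}$, a two-form with values in $\operatorname{End}E$. Let $\mathcal C=\mathcal C(E)=\{J\in\operatorname{End}E : J^2=-1\}$, a submanifold of the total space of $\operatorname{End}E$, and let $\pi:\mathcal C\to M$ be the projection. For $J\in\mathcal C$ over $x=\pi(J)$ the tangent space splits as $T_J\mathcal C=V_J\oplus H_J$, where $V_J=\ker \pi_*=\{B\in\operatorname{End}E_x : BJ+JB=0\}$ is the vertical space and $H_J$ is the horizontal space, consisting of the velocities $\frac{d}{dt}J(t)|_{t=0}$ of the $\nabla$-parallel translates $J(t)$ of $J$ along curves in $M$ that start at $x$. Let $P:T_J\mathcal C\to V_J\subset\operatorname{End}E_x$ be the projection along $H_J$. Define the almost complex structure $\mathcal J=\mathcal J^{(\nabla,I)}$ on $\mathcal C$ by $\mathcal J B=JB$ for $B\in V_J$ and $\mathcal J v^\nabla=(Iv)^\nabla$ for $v\in T_xM$, where $v^\nabla\in H_J$ denotes the horizontal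 lift of $v$. For an almost complex structure $K$ let $N^K(X,Y)=[KX,KY]-K[KX,Y]-K[X,KY]-[X,Y]$ be its Nijenhuis tensor. Then for all $J\in\mathcal C$ and $X,Y\in T_J\mathcal C$, with $v=\pi_*X$ and $w=\pi_*Y$, $$\pi_*N^{\mathcal J}(X,Y)=N^I(v,w),$$ $$P\,N^{\mathcal J}(X,Y)=[R(v,w)-R(Iv,Iw),\,J]+J\,[R(Iv,w)+R(v,Iw),\,J],$$ where the brackets on the right-hand side of the second identity are commutators in $\operatorname{End}E_{\pi(J)}$. -/

import Mathlib

open Bundle FiberBundle Module VectorField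
open scoped Manifold ContDiff Topology

set_option linter.unusedSectionVars false

noncomputable section

section LinearTwistor

variable {F : Type*} [NormedAddCommGroup F] [NormedSpace ℝ F]

/-- The tangent space `{a ∈ End F | a j + j a = 0}` at `j` of the space of complex structures. -/
def antiComm (j : F →L[ℝ] F) : Submodule ℝ (F →L[ℝ] F) where
  carrier := {a | a * j + j * a = 0}
  add_mem' := by
    intro a b ha hb
    change (a + b) * j + j * (a + b) = 0
    have h : a * j + j * a + (b * j + j * b) = 0 := by rw [ha, hb, add_zero]
    rw [← h, add_mul, mul_add]; abel
  zero_mem' := by simp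
  smul_mem' := by
    intro c a ha
    change c • a * j + j * (c • a) = 0
    rw [smul_mul_assoc, mul_smul_comm, ← smul_add, show a * j + j * a = 0 from ha, smul_zero]

/-- Model vector space for the space of complex structures on `F`; its dimension is `2 n ^ 2`
when `dim F = 2 n`. -/
abbrev TwistorModel (F : Type*) [NormedAddCommGroup F] [NormedSpace ℝ F] : Type :=
  EuclideanSpace ℝ (Fin (finrank ℝ F ^ 2 / 2))

theorem exists_conj [FiniteDimensional ℝ F] (j : F →L[ℝ] F) (hj : j * j = -1) :
    ∃ c : F →L[ℝ] F, c * c = 1 ∧ c * j = - (j * c) := by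
  have hj' : (j : F →ₗ[ℝ] F) * (j : F →ₗ[ℝ] F) = -1 := by
    ext v
    exact congr($hj v)
  let φ : ℂ →ₐ[ℝ] Module.End ℝ F := Complex.lift ⟨(j : F →ₗ[ℝ] F), hj'⟩
  let _ : Module ℂ F := Module.compHom F φ.toRingHom
  have hsm (z : ℂ) (v : F) : z • v = φ z v := rfl
  have : IsScalarTower ℝ ℂ F := ⟨fun r z v => by simp [hsm]⟩
  have : Module.Finite ℂ F := Module.Finite.of_restrictScalars_finite ℝ ℂ F
  let b := Module.finBasis ℂ F
  let E := b.equivFun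
  let c₀ : F → F := fun v => E.symm (fun i => (starRingEnd ℂ) (E v i))
  have hI (v : F) : j v = Complex.I • v := by simp [hsm, φ]
  let c₁ : F →ₗ[ℝ] F :=
    { toFun := c₀
      map_add' := fun v w => by
        simp only [c₀]; rw [← map_add]; congr 1; ext i; simp
      map_smul' := fun r v => by
        simp only [c₀, RingHom.id_apply]
        have : ∀ u : F, r • u = (r : ℂ) • u := fun u => by
          rw [← Complex.coe_algebraMap, algebraMap_smul]
        rw [this (E.symm _), ← map_smul]; congr 1; ext i; rw [this v, map_smul]; simp }
  refine ⟨LinearMap.toContinuousLinearMap c₁, ?_, ?_⟩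
  · ext v
    change c₀ (c₀ v) = v
    simp [c₀]
  · ext v
    change c₀ (j v) = - j (c₀ v)
    rw [hI, hI]
    simp only [c₀]
    rw [← map_smul, ← map_neg]
    congr 1; ext i; simp

theorem finrank_antiComm [FiniteDimensional ℝ F] (j : F →L[ℝ] F) (hj : j * j = -1) :
    finrank ℝ (antiComm j) = finrank ℝ (TwistorModel F) := by
  obtain ⟨c, hc, hcj⟩ := exists_conj j hj
  let comm : Submodule ℝ (F →L[ℝ] F) :=
    { carrier := {a | a * j = j * a}
      add_mem' := by intro a b ha hb; simp_all [add_mul, mul_add]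
      zero_mem' := by simp
      smul_mem' := by intro c a ha; simp_all }
  have hjc : j * c = - (c * j) := by rw [hcj, neg_neg]
  let E : antiComm j ≃ₗ[ℝ] comm :=
    { toFun := fun a => ⟨a.1 * c, by
        have h : a.1 * j + j * a.1 = 0 := a.2
        have h' : a.1 * j = - (j * a.1) := eq_neg_of_add_eq_zero_left h
        change a.1 * c * j = j * (a.1 * c)
        rw [mul_assoc, hcj, mul_neg, ← mul_assoc, h', neg_mul, neg_neg, mul_assoc]⟩
      map_add' := fun a b => by ext1; simp [add_mul]
      map_smul' := fun r a => by ext1; simp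
      invFun := fun a => ⟨a.1 * c, by
        have h : a.1 * j = j * a.1 := a.2
        change a.1 * c * j + j * (a.1 * c) = 0
        rw [mul_assoc, hcj, mul_neg, ← mul_assoc, h, mul_assoc, neg_add_cancel]⟩
      left_inv := fun a => by ext1; simp [mul_assoc, hc]
      right_inv := fun a => by ext1; simp [mul_assoc, hc] }
  have hcompl : IsCompl (antiComm j) comm := by
    have key (a : F →L[ℝ] F) : a = (1/2 : ℝ) • (a + j * a * j) + (1/2 : ℝ) • (a - j * a * j) := by
      module
    constructor
    · rw [Submodule.disjoint_def]
      intro a (h1 : a * j + j * a = 0) (h2 : a * j = j * a)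
      rw [← h2, ← two_smul ℝ, smul_eq_zero] at h1
      have h3 : a * j = 0 := by simpa using h1
      calc a = - (a * (j * j)) := by rw [hj]; simp
        _ = 0 := by rw [← mul_assoc, h3]; simp
    · rw [codisjoint_iff, eq_top_iff]
      intro a _
      rw [key a]
      refine Submodule.add_mem_sup (Submodule.smul_mem _ _ ?_) (Submodule.smul_mem _ _ ?_)
      · change (a + j * a * j) * j + j * (a + j * a * j) = 0
        have h1 : j * a * j * j = - (j * a) := by rw [mul_assoc, hj]; simp
        have h2 : j * (j * a * j) = - (a * j) := by
          rw [mul_assoc, ← mul_assoc j j, hj]; simp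
        rw [add_mul, mul_add, h1, h2]; abel
      · change (a - j * a * j) * j = j * (a - j * a * j)
        have h1 : j * a * j * j = - (j * a) := by rw [mul_assoc, hj]; simp
        have h2 : j * (j * a * j) = - (a * j) := by
          rw [mul_assoc, ← mul_assoc j j, hj]; simp
        rw [sub_mul, mul_sub, h1, h2]; abel
  have h1 := Submodule.finrank_add_eq_of_isCompl hcompl
  rw [← E.finrank_eq] at h1
  have h2 : finrank ℝ (F →L[ℝ] F) = finrank ℝ F ^ 2 := by
    rw [← (LinearMap.toContinuousLinearMap (𝕜 := ℝ) (E := F) (F' := F)).finrank_eq,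
      Module.finrank_linearMap, sq]
  rw [h2] at h1
  simp only [finrank_euclideanSpace, Fintype.card_fin]
  omega

/-- The projection `a ↦ (a + j a j) / 2` of `End F` onto the tangent space at `j`. -/
def antiCommProj [FiniteDimensional ℝ F] (j : F →L[ℝ] F) (hj : j * j = -1) :
    (F →L[ℝ] F) →L[ℝ] antiComm j :=
  LinearMap.toContinuousLinearMap
    { toFun := fun a => ⟨(1 / 2 : ℝ) • (a + j * a * j), by
        refine Submodule.smul_mem _ _ ?_
        change (a + j * a * j) * j + j * (a + j * a * j) = 0
        have h1 : j * a * j * j = - (j * a) := by rw [mul_assoc, hj]; simp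
        have h2 : j * (j * a * j) = - (a * j) := by
          rw [mul_assoc, ← mul_assoc j j, hj]; simp
        rw [add_mul, mul_add, h1, h2]; abel⟩
      map_add' := fun a b => by
        ext1
        simp only [Submodule.coe_add]
        rw [mul_add, add_mul]; module
      map_smul' := fun r a => by
        ext1
        simp only [Submodule.coe_smul, RingHom.id_apply, mul_smul_comm, smul_mul_assoc]
        module }

theorem antiCommProj_apply [FiniteDimensional ℝ F] (j : F →L[ℝ] F) (hj : j * j = -1)
    (a : F →L[ℝ] F) (ha : a * j + j * a = 0) : (antiCommProj j hj a : F →L[ℝ] F) = a := by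
  change (1 / 2 : ℝ) • (a + j * a * j) = a
  have h : a * j = - (j * a) := eq_neg_of_add_eq_zero_left ha
  have : j * a * j = a := by rw [mul_assoc, h, mul_neg, ← mul_assoc, hj]; simp
  rw [this]; module

/-- Coordinates on the tangent space at `j`. -/
def antiCommEquiv [FiniteDimensional ℝ F] (j : F →L[ℝ] F) (hj : j * j = -1) :
    antiComm j ≃L[ℝ] TwistorModel F :=
  ContinuousLinearEquiv.ofFinrankEq (finrank_antiComm j hj)

/-- The Cayley chart `b ↦ (b + j)⁻¹ (j - b)` at `j` on the space of complex structures. -/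
def cayley [FiniteDimensional ℝ F] (j : F →L[ℝ] F) (hj : j * j = -1) (b : F →L[ℝ] F) :
    TwistorModel F :=
  antiCommEquiv j hj (antiCommProj j hj (Ring.inverse (b + j) * (j - b)))

/-- The inverse `a ↦ (1 + a) j (1 + a)⁻¹` of the Cayley chart at `j`. -/
def cayleyInv [FiniteDimensional ℝ F] (j : F →L[ℝ] F) (hj : j * j = -1) (k : TwistorModel F) :
    F →L[ℝ] F :=
  (1 + ((antiCommEquiv j hj).symm k : F →L[ℝ] F)) * j *
    Ring.inverse (1 + ((antiCommEquiv j hj).symm k : F →L[ℝ] F))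

section Cayley

variable [FiniteDimensional ℝ F] (j : F →L[ℝ] F) (hj : j * j = -1)

theorem isUnit_two {F : Type*} [NormedAddCommGroup F] [NormedSpace ℝ F] : IsUnit (2 : F →L[ℝ] F) :=
  have h : (1 / 2 : ℝ) • (2 : F →L[ℝ] F) = 1 := by
    rw [← one_add_one_eq_two (R := F →L[ℝ] F), smul_add, ← add_smul]; norm_num
  ⟨⟨2, (1 / 2 : ℝ) • 1, by rw [mul_smul_comm, mul_one, h],
    by rw [smul_mul_assoc, one_mul, h]⟩, rfl⟩

theorem isUnit_of_sq {F : Type*} [NormedAddCommGroup F] [NormedSpace ℝ F] (j : F →L[ℝ] F)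
    (hj : j * j = -1) : IsUnit j :=
  ⟨⟨j, -j, by rw [mul_neg, hj, neg_neg], by rw [neg_mul, hj, neg_neg]⟩, rfl⟩

theorem cayleyInv_sq (k : TwistorModel F)
    (hk : IsUnit (1 + ((antiCommEquiv j hj).symm k : F →L[ℝ] F))) :
    cayleyInv j hj k * cayleyInv j hj k = -1 := by
  unfold cayleyInv
  obtain ⟨u, hu⟩ := hk
  rw [← hu, Ring.inverse_unit]
  calc (u : F →L[ℝ] F) * j * ↑u⁻¹ * (↑u * j * ↑u⁻¹) = u * (j * (↑u⁻¹ * ↑u) * j) * ↑u⁻¹ := by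
        simp only [mul_assoc]
    _ = -1 := by rw [Units.inv_mul, mul_one, hj]; simp

theorem cayleyInv_add (k : TwistorModel F)
    (hk : IsUnit (1 + ((antiCommEquiv j hj).symm k : F →L[ℝ] F))) :
    cayleyInv j hj k + j =
      2 * j * Ring.inverse (1 + ((antiCommEquiv j hj).symm k : F →L[ℝ] F)) := by
  unfold cayleyInv
  set a := ((antiCommEquiv j hj).symm k : F →L[ℝ] F) with ha
  have h : a * j + j * a = 0 := ((antiCommEquiv j hj).symm k).2
  have h2 : j = j * (1 + a) * Ring.inverse (1 + a) := by
    rw [mul_assoc, Ring.mul_inverse_cancel _ hk, mul_one]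
  nth_rewrite 2 [h2]
  rw [← add_mul]
  congr 1
  rw [add_mul, mul_add]
  calc 1 * j + a * j + (j * 1 + j * a) = 2 * j + (a * j + j * a) := by
        rw [one_mul, mul_one, two_mul]; abel
    _ = 2 * j := by rw [h, add_zero]

theorem isUnit_cayleyInv_add (k : TwistorModel F)
    (hk : IsUnit (1 + ((antiCommEquiv j hj).symm k : F →L[ℝ] F))) :
    IsUnit (cayleyInv j hj k + j) := by
  rw [cayleyInv_add j hj k hk]
  exact (isUnit_two.mul (isUnit_of_sq j hj)).mul hk.ringInverse

theorem cayley_cayleyInv (k : TwistorModel F)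
    (hk : IsUnit (1 + ((antiCommEquiv j hj).symm k : F →L[ℝ] F))) :
    cayley j hj (cayleyInv j hj k) = k := by
  have hu := isUnit_cayleyInv_add j hj k hk
  have key : Ring.inverse (cayleyInv j hj k + j) * (j - cayleyInv j hj k) =
      ((antiCommEquiv j hj).symm k : F →L[ℝ] F) := by
    have h : ((antiCommEquiv j hj).symm k : F →L[ℝ] F) * j +
      j * ((antiCommEquiv j hj).symm k : F →L[ℝ] F) = 0 := ((antiCommEquiv j hj).symm k).2
    have h' : (cayleyInv j hj k + j) * ((antiCommEquiv j hj).symm k : F →L[ℝ] F) =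
        j - cayleyInv j hj k := by
      have hb : cayleyInv j hj k * (1 + ((antiCommEquiv j hj).symm k : F →L[ℝ] F)) =
          (1 + ((antiCommEquiv j hj).symm k : F →L[ℝ] F)) * j := by
        unfold cayleyInv
        rw [mul_assoc, Ring.inverse_mul_cancel _ hk, mul_one]
      rw [mul_add, mul_one, add_mul, one_mul] at hb
      rw [add_mul, eq_sub_iff_add_eq]
      calc _ = (cayleyInv j hj k + cayleyInv j hj k * _) + j * _ := by abel
        _ = _ := by rw [hb, add_assoc, h, add_zero]
    rw [← h', ← mul_assoc, Ring.inverse_mul_cancel _ hu, one_mul]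
  unfold cayley
  rw [key]
  have : antiCommProj j hj ((antiCommEquiv j hj).symm k : F →L[ℝ] F) =
      (antiCommEquiv j hj).symm k := by
    ext1
    exact antiCommProj_apply j hj _ ((antiCommEquiv j hj).symm k).2
  rw [this]; simp

theorem symm_cayley (b : F →L[ℝ] F) (hb : b * b = -1) (hu : IsUnit (b + j)) :
    ((antiCommEquiv j hj).symm (cayley j hj b) : F →L[ℝ] F) =
      Ring.inverse (b + j) * (j - b) := by
  unfold cayley
  rw [ContinuousLinearEquiv.symm_apply_apply]
  refine antiCommProj_apply j hj _ ?_
  have h1 : Ring.inverse (b + j) * b = j * Ring.inverse (b + j) := by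
    have : b * (b + j) = (b + j) * j := by rw [mul_add, add_mul, hb, hj, add_comm]
    calc Ring.inverse (b + j) * b
        = Ring.inverse (b + j) * (b * (b + j)) * Ring.inverse (b + j) := by
          rw [mul_assoc, mul_assoc b, Ring.mul_inverse_cancel _ hu, mul_one]
      _ = j * Ring.inverse (b + j) := by
          rw [this, ← mul_assoc, Ring.inverse_mul_cancel _ hu, one_mul]
  have h2 : (j - b) * j = - (b * (j - b)) := by
    rw [sub_mul, mul_sub, hj, hb]; abel
  rw [mul_assoc, h2, mul_neg, ← mul_assoc, h1, mul_assoc, neg_add_cancel]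

theorem one_add_symm_cayley (b : F →L[ℝ] F) (hb : b * b = -1) (hu : IsUnit (b + j)) :
    1 + ((antiCommEquiv j hj).symm (cayley j hj b) : F →L[ℝ] F) =
      Ring.inverse (b + j) * (2 * j) := by
  rw [symm_cayley j hj b hb hu]
  nth_rewrite 1 [← Ring.inverse_mul_cancel _ hu]
  rw [← mul_add, two_mul]
  congr 1; abel

theorem isUnit_one_add_symm_cayley (b : F →L[ℝ] F) (hb : b * b = -1) (hu : IsUnit (b + j)) :
    IsUnit (1 + ((antiCommEquiv j hj).symm (cayley j hj b) : F →L[ℝ] F)) := by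
  rw [one_add_symm_cayley j hj b hb hu]
  exact hu.ringInverse.mul (isUnit_two.mul (isUnit_of_sq j hj))

theorem cayleyInv_cayley (b : F →L[ℝ] F) (hb : b * b = -1) (hu : IsUnit (b + j)) :
    cayleyInv j hj (cayley j hj b) = b := by
  have h1 := isUnit_one_add_symm_cayley j hj b hb hu
  have h : (1 + ((antiCommEquiv j hj).symm (cayley j hj b) : F →L[ℝ] F)) * j =
      b * (1 + ((antiCommEquiv j hj).symm (cayley j hj b) : F →L[ℝ] F)) := by
    rw [one_add_symm_cayley j hj b hb hu]
    have : b * (b + j) = (b + j) * j := by rw [mul_add, add_mul, hb, hj, add_comm]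
    have h3 : b * Ring.inverse (b + j) = Ring.inverse (b + j) * (b + j) * b *
        Ring.inverse (b + j) := by rw [Ring.inverse_mul_cancel _ hu, one_mul]
    have h4 : (b + j) * b = j * (b + j) := by rw [mul_add, add_mul, hb, hj, add_comm]
    rw [← mul_assoc b, h3, mul_assoc (Ring.inverse (b + j)) (b + j) b, h4]
    rw [mul_assoc (Ring.inverse (b + j)) (j * (b + j)), mul_assoc j, Ring.mul_inverse_cancel _ hu,
      mul_one]
    simp only [mul_assoc, two_mul, mul_add, add_mul]
  unfold cayleyInv
  rw [h, mul_assoc, Ring.mul_inverse_cancel _ h1, mul_one]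

theorem contDiffAt_cayley {b : F →L[ℝ] F} (hu : IsUnit (b + j)) :
    ContDiffAt ℝ ∞ (cayley j hj) b := by
  have : CompleteSpace F := FiniteDimensional.complete ℝ F
  obtain ⟨u, hu⟩ := hu
  have h1 : ContDiffAt ℝ ∞ (fun b : F →L[ℝ] F => Ring.inverse (b + j)) b := by
    have := contDiffAt_ringInverse ℝ u (n := ∞)
    rw [hu] at this
    exact this.comp b (contDiffAt_id.add contDiffAt_const)
  have h2 : ContDiffAt ℝ ∞ (fun b : F →L[ℝ] F => Ring.inverse (b + j) * (j - b)) b :=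
    h1.mul (contDiffAt_const.sub contDiffAt_id)
  have h3 : ContDiff ℝ ∞ (fun a => antiCommEquiv j hj (antiCommProj j hj a)) :=
    ((antiCommEquiv j hj : antiComm j →L[ℝ] TwistorModel F).comp (antiCommProj j hj)).contDiff
  exact h3.contDiffAt.comp b h2

theorem contDiffAt_cayleyInv {k : TwistorModel F}
    (hk : IsUnit (1 + ((antiCommEquiv j hj).symm k : F →L[ℝ] F))) :
    ContDiffAt ℝ ∞ (cayleyInv j hj) k := by
  have : CompleteSpace F := FiniteDimensional.complete ℝ F
  obtain ⟨u, hu⟩ := hk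
  have h0' : ContDiff ℝ ∞
      (fun k : TwistorModel F => ((antiCommEquiv j hj).symm k : F →L[ℝ] F)) :=
    ((antiComm j).subtypeL.comp
      ((antiCommEquiv j hj).symm : TwistorModel F →L[ℝ] antiComm j)).contDiff
  have h0 : ContDiff ℝ ∞
      (fun k : TwistorModel F => 1 + ((antiCommEquiv j hj).symm k : F →L[ℝ] F)) :=
    contDiff_const.add h0'
  have h1 : ContDiffAt ℝ ∞ (fun k : TwistorModel F =>
      Ring.inverse (1 + ((antiCommEquiv j hj).symm k : F →L[ℝ] F))) k := by
    have := contDiffAt_ringInverse ℝ u (n := ∞)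
    rw [hu] at this
    exact this.comp k h0.contDiffAt
  exact (h0.contDiffAt.mul contDiffAt_const).mul h1

end Cayley

end LinearTwistor

section TwistorSpace

variable {EB : Type*} [NormedAddCommGroup EB] [NormedSpace ℝ EB]
  {M : Type*} [TopologicalSpace M] [ChartedSpace EB M]
  {F : Type*} [NormedAddCommGroup F] [NormedSpace ℝ F]
  {V : M → Type*} [∀ x, AddCommGroup (V x)] [∀ x, Module ℝ (V x)]
  [TopologicalSpace (TotalSpace F V)] [∀ x, TopologicalSpace (V x)]
  [FiberBundle F V] [VectorBundle ℝ F V]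
  [∀ x, IsTopologicalAddGroup (V x)] [∀ x, ContinuousSMul ℝ (V x)]

/-- The total space of the bundle `End V`. -/
abbrev EndTotal {M : Type*} (F : Type*) [NormedAddCommGroup F] [NormedSpace ℝ F]
    (V : M → Type*) [∀ x, AddCommGroup (V x)] [∀ x, Module ℝ (V x)]
    [∀ x, TopologicalSpace (V x)] : Type _ :=
  TotalSpace (F →L[ℝ] F) (fun x => V x →L[ℝ] V x)

/-- The twistor space `C(V) = {J ∈ End V | J ^ 2 = -1}`, as a subspace of the total space of
`End V`. -/
@[ext] structure TwistorSpace {M : Type*} (F : Type*) [NormedAddCommGroup F] [NormedSpace ℝ F]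
    (V : M → Type*) [∀ x, AddCommGroup (V x)] [∀ x, Module ℝ (V x)]
    [∀ x, TopologicalSpace (V x)] [∀ x, IsTopologicalAddGroup (V x)] : Type _ where
  /-- The inclusion of the twistor space into the total space of `End V`. -/
  toEnd : EndTotal F V
  sq : toEnd.2 * toEnd.2 = -1

namespace TwistorSpace

instance : TopologicalSpace (TwistorSpace F V) :=
  TopologicalSpace.induced toEnd inferInstance

/-- The projection of the twistor space to the base manifold. -/
abbrev proj (J : TwistorSpace F V) : M := J.toEnd.proj

/-- The standard chart of the total space of `End V` at `A`. -/
abbrev endChart (A : EndTotal F V) :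
    OpenPartialHomeomorph (EndTotal F V) (ModelProd EB (F →L[ℝ] F)) :=
  chartAt (ModelProd EB (F →L[ℝ] F)) A

theorem endChart_sq {EB : Type*} [NormedAddCommGroup EB] [ChartedSpace EB M] (A₀ A : EndTotal F V) (hA : A ∈ (endChart (EB := EB) A₀).source) :
    (endChart (EB := EB) A₀ A).2 * (endChart (EB := EB) A₀ A).2 = -1 ↔ A.2 * A.2 = -1 := by
  have hb : A.proj ∈ (trivializationAt F V A₀.proj).baseSet := by
    rw [endChart, FiberBundle.chartedSpace_chartAt] at hA
    simp only [mfld_simps] at hA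
    simpa using hA.1
  set e := trivializationAt F V A₀.proj
  let L : V A.proj ≃L[ℝ] F := e.continuousLinearEquivAt ℝ A.proj hb
  have h : (endChart (EB := EB) A₀ A).2 =
      (L : V A.proj →L[ℝ] F) ∘L A.2 ∘L (L.symm : F →L[ℝ] V A.proj) := by
    rw [hom_chart]
    ext v
    simp [ContinuousLinearMap.inCoordinates, L, e, hb, Trivialization.linearMapAt_apply]
  rw [h]
  constructor
  · intro h2
    ext v
    have := congr(L.symm ($h2 (L v)))
    simpa using this
  · intro h2
    ext v
    have := congr(L ($h2 (L.symm v)))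
    simpa using this


variable [FiniteDimensional ℝ F]

variable (EB) in
/-- The coordinate of `J` in the standard chart at `J`. -/
abbrev base (J : TwistorSpace F V) : F →L[ℝ] F :=
  (endChart (EB := EB) J.1 J.1).2

theorem base_sq {EB : Type*} [NormedAddCommGroup EB] [ChartedSpace EB M] (J : TwistorSpace F V) : base EB J * base EB J = -1 :=
  (endChart_sq J.1 J.1 (mem_chart_source _ _)).2 J.2

variable (EB) in
/-- The set of points over which the chart at `J` is defined, in `End V`. -/
def ambientSource (J : TwistorSpace F V) : Set (EndTotal F V) :=
  (endChart (EB := EB) J.1).source ∩ endChart (EB := EB) J.1 ⁻¹' {p | IsUnit (p.2 + base EB J)}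

variable (EB) in
/-- The chart at `J`, as a map on the total space of `End V`. -/
def ambientChart (J : TwistorSpace F V) (A : EndTotal F V) : EB × TwistorModel F :=
  ((endChart (EB := EB) J.1 A).1, cayley (base EB J) (base_sq J) (endChart (EB := EB) J.1 A).2)

variable (EB) in
/-- The point `(h, θ k)` of the model of `End V`, with `θ` the inverse Cayley chart. -/
def modelInv (J : TwistorSpace F V) (p : EB × TwistorModel F) : ModelProd EB (F →L[ℝ] F) :=
  (p.1, cayleyInv (base EB J) (base_sq J) p.2)

variable (EB) in
/-- The target of the chart at `J`. -/
def chartTarget (J : TwistorSpace F V) : Set (EB × TwistorModel F) :=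
  {p | IsUnit (1 + ((antiCommEquiv (base EB J) (base_sq J)).symm p.2 : F →L[ℝ] F))} ∩
    modelInv EB J ⁻¹' (endChart (EB := EB) J.1).target

variable (EB) in
/-- The inverse of the chart at `J`, as a map to the total space of `End V`. -/
def ambientInv (J : TwistorSpace F V) (p : EB × TwistorModel F) : EndTotal F V :=
  (endChart (EB := EB) J.1).symm (modelInv EB J p)

theorem endChart_ambientInv (J : TwistorSpace F V) {p : EB × TwistorModel F}
    (hp : p ∈ chartTarget EB J) : endChart (EB := EB) J.1 (ambientInv EB J p) = modelInv EB J p :=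
  (endChart (EB := EB) J.1).right_inv hp.2

theorem ambientInv_mem_source (J : TwistorSpace F V) {p : EB × TwistorModel F}
    (hp : p ∈ chartTarget EB J) : ambientInv EB J p ∈ (endChart (EB := EB) J.1).source :=
  (endChart (EB := EB) J.1).map_target hp.2

theorem ambientInv_sq (J : TwistorSpace F V) {p : EB × TwistorModel F}
    (hp : p ∈ chartTarget EB J) : (ambientInv EB J p).2 * (ambientInv EB J p).2 = -1 := by
  rw [← endChart_sq J.1 _ (ambientInv_mem_source J hp), endChart_ambientInv J hp]
  exact cayleyInv_sq _ (base_sq J) _ hp.1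

theorem isOpen_ambientSource (J : TwistorSpace F V) : IsOpen (ambientSource EB J) := by
  have : CompleteSpace F := FiniteDimensional.complete ℝ F
  refine (endChart (EB := EB) J.1).continuousOn.isOpen_inter_preimage
    (endChart (EB := EB) J.1).open_source ?_
  have hc : Continuous fun p : EB × (F →L[ℝ] F) => p.2 + base EB J := by fun_prop
  exact Units.isOpen.preimage hc

theorem contDiffOn_modelInv (J : TwistorSpace F V) :
    ContDiffOn ℝ ∞ (fun p : EB × TwistorModel F =>
      ((p.1, cayleyInv (base EB J) (base_sq J) p.2) : EB × (F →L[ℝ] F)))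
      {p | IsUnit (1 + ((antiCommEquiv (base EB J) (base_sq J)).symm p.2 : F →L[ℝ] F))} := by
  intro p hp
  exact (contDiffAt_fst.prodMk
    ((contDiffAt_cayleyInv (base EB J) (base_sq J) hp).comp p contDiffAt_snd)).contDiffWithinAt

theorem isOpen_chartTarget (J : TwistorSpace F V) : IsOpen (chartTarget EB J) := by
  have : CompleteSpace F := FiniteDimensional.complete ℝ F
  refine (contDiffOn_modelInv J).continuousOn.isOpen_inter_preimage ?_
    (endChart (EB := EB) J.1).open_target
  have hc : Continuous fun p : EB × TwistorModel F =>
      1 + ((antiCommEquiv (base EB J) (base_sq J)).symm p.2 : F →L[ℝ] F) := by fun_prop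
  exact Units.isOpen.preimage hc

theorem contDiffOn_cayleyModel (J : TwistorSpace F V) :
    ContDiffOn ℝ ∞ (fun p : EB × (F →L[ℝ] F) =>
      ((p.1, cayley (base EB J) (base_sq J) p.2) : EB × TwistorModel F))
      {p | IsUnit (p.2 + base EB J)} := by
  intro p hp
  exact (contDiffAt_fst.prodMk
    ((contDiffAt_cayley (base EB J) (base_sq J) hp).comp p contDiffAt_snd)).contDiffWithinAt

theorem ambientChart_mem_target (J : TwistorSpace F V) {A : EndTotal F V}
    (hA : A ∈ ambientSource EB J) (hA2 : A.2 * A.2 = -1) :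
    ambientChart EB J A ∈ chartTarget EB J ∧ ambientInv EB J (ambientChart EB J A) = A := by
  have hsq := (endChart_sq (EB := EB) J.1 A hA.1).2 hA2
  have h1 : modelInv EB J (ambientChart EB J A) = endChart (EB := EB) J.1 A := by
    unfold modelInv ambientChart
    dsimp only
    rw [cayleyInv_cayley _ (base_sq J) _ hsq hA.2]
    rfl
  refine ⟨⟨isUnit_one_add_symm_cayley _ (base_sq J) _ hsq hA.2, ?_⟩, ?_⟩
  · rw [Set.mem_preimage, h1]
    exact (endChart (EB := EB) J.1).map_source hA.1
  · unfold ambientInv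
    rw [h1]
    exact (endChart (EB := EB) J.1).left_inv hA.1

theorem ambientInv_mem_ambientSource (J : TwistorSpace F V) {p : EB × TwistorModel F}
    (hp : p ∈ chartTarget EB J) :
    ambientInv EB J p ∈ ambientSource EB J ∧ ambientChart EB J (ambientInv EB J p) = p := by
  refine ⟨⟨ambientInv_mem_source J hp, ?_⟩, ?_⟩
  · rw [Set.mem_preimage, endChart_ambientInv J hp]
    exact isUnit_cayleyInv_add _ (base_sq J) _ hp.1
  · unfold ambientChart
    rw [endChart_ambientInv J hp]
    unfold modelInv
    rw [cayley_cayleyInv _ (base_sq J) _ hp.1]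

variable (EB) in
open Classical in
/-- The chart of the twistor space at `J`: in the trivialization of `End V` at the base point of
`J` it is the product of the chart of the base manifold and the Cayley chart at `J`. -/
def chart (J : TwistorSpace F V) : OpenPartialHomeomorph (TwistorSpace F V) (EB × TwistorModel F) where
  toFun A := ambientChart EB J A.1
  invFun p := if hp : p ∈ chartTarget EB J then ⟨ambientInv EB J p, ambientInv_sq J hp⟩ else J
  source := toEnd ⁻¹' ambientSource EB J
  target := chartTarget EB J
  map_source' A hA := (ambientChart_mem_target J hA A.2).1
  map_target' p hp := by
    rw [dif_pos hp]
    exact (ambientInv_mem_ambientSource J hp).1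
  left_inv' A hA := by
    rw [dif_pos (ambientChart_mem_target J hA A.2).1]
    exact TwistorSpace.ext (ambientChart_mem_target J hA A.2).2
  right_inv' p hp := by
    rw [dif_pos hp]
    exact (ambientInv_mem_ambientSource J hp).2
  open_source := (isOpen_ambientSource J).preimage continuous_induced_dom
  open_target := isOpen_chartTarget J
  continuousOn_toFun := by
    have h : ContinuousOn (ambientChart EB J) (ambientSource EB J) :=
      (contDiffOn_cayleyModel (EB := EB) J).continuousOn.comp
        ((endChart (EB := EB) J.1).continuousOn.mono Set.inter_subset_left) (fun A hA => hA.2)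
    exact h.comp continuous_induced_dom.continuousOn (fun A hA => hA)
  continuousOn_invFun := by
    refine (Topology.IsInducing.induced toEnd).continuousOn_iff.2 ?_
    have h : ContinuousOn (ambientInv EB J) (chartTarget EB J) :=
      (endChart (EB := EB) J.1).continuousOn_symm.comp
        ((contDiffOn_modelInv J).continuousOn.mono Set.inter_subset_left) (fun p hp => hp.2)
    refine h.congr fun p hp => ?_
    simp only [Function.comp_apply]
    rw [dif_pos hp]

theorem mem_chart_source (J : TwistorSpace F V) : J ∈ (chart EB J).source := by
  refine ⟨ChartedSpace.mem_chart_source _, ?_⟩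
  change IsUnit (base EB J + base EB J)
  rw [← two_mul]
  exact isUnit_two.mul (isUnit_of_sq _ (base_sq J))

/-- The twistor space is a manifold modelled on `EB × TwistorModel F`. -/
instance : ChartedSpace (EB × TwistorModel F) (TwistorSpace F V) where
  atlas := Set.range (chart EB)
  chartAt := chart EB
  mem_chart_source := mem_chart_source
  chart_mem_atlas J := Set.mem_range_self J

variable [IsManifold 𝓘(ℝ, EB) ∞ M] [ContMDiffVectorBundle ∞ F V 𝓘(ℝ, EB)]

theorem contMDiffOn_ambientChart (J : TwistorSpace F V) :
    ContMDiffOn (𝓘(ℝ, EB).prod 𝓘(ℝ, F →L[ℝ] F)) 𝓘(ℝ, EB × TwistorModel F) ∞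
      (ambientChart EB J) (ambientSource EB J) := by
  have h1 : ContMDiffOn (𝓘(ℝ, EB).prod 𝓘(ℝ, F →L[ℝ] F)) (𝓘(ℝ, EB).prod 𝓘(ℝ, F →L[ℝ] F)) ∞
    (endChart (EB := EB) J.1) (endChart (EB := EB) J.1).source := contMDiffOn_chart
  have h2 := (contDiffOn_cayleyModel (EB := EB) J).contMDiffOn
  rw [modelWithCornersSelf_prod (E := EB) (F := F →L[ℝ] F)] at h2
  exact ContMDiffOn.comp (I' := 𝓘(ℝ, EB).prod 𝓘(ℝ, F →L[ℝ] F)) (M' := ModelProd EB (F →L[ℝ] F)) h2 (h1.mono Set.inter_subset_left) (fun A hA => hA.2)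

theorem contMDiffOn_ambientInv (J : TwistorSpace F V) :
    ContMDiffOn 𝓘(ℝ, EB × TwistorModel F) (𝓘(ℝ, EB).prod 𝓘(ℝ, F →L[ℝ] F)) ∞
      (ambientInv EB J) (chartTarget EB J) := by
  have h1 : ContMDiffOn (𝓘(ℝ, EB).prod 𝓘(ℝ, F →L[ℝ] F)) (𝓘(ℝ, EB).prod 𝓘(ℝ, F →L[ℝ] F)) ∞
    (endChart (EB := EB) J.1).symm (endChart (EB := EB) J.1).target := contMDiffOn_chart_symm
  have h2 := (contDiffOn_modelInv (EB := EB) J).contMDiffOn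
  rw [modelWithCornersSelf_prod (E := EB) (F := F →L[ℝ] F)] at h2
  exact ContMDiffOn.comp (I' := 𝓘(ℝ, EB).prod 𝓘(ℝ, F →L[ℝ] F)) (M' := ModelProd EB (F →L[ℝ] F)) h1 (h2.mono Set.inter_subset_left) (fun p hp => hp.2)

instance : IsManifold 𝓘(ℝ, EB × TwistorModel F) ∞ (TwistorSpace F V) := by
  refine isManifold_of_contDiffOn _ _ _ ?_
  rintro _ _ ⟨J, rfl⟩ ⟨J', rfl⟩
  have h0 : ContMDiffOn 𝓘(ℝ, EB × TwistorModel F) (𝓘(ℝ, EB).prod 𝓘(ℝ, F →L[ℝ] F)) ∞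
      (ambientInv EB J) (chartTarget EB J ∩ ambientInv EB J ⁻¹' ambientSource EB J') :=
    (contMDiffOn_ambientInv (EB := EB) J).mono Set.inter_subset_left
  have h := (contMDiffOn_ambientChart (EB := EB) J').comp h0 (fun p hp => hp.2)
  rw [contMDiffOn_iff_contDiffOn] at h
  simp only [modelWithCornersSelf_coe, modelWithCornersSelf_coe_symm, Set.range_id,
    Set.preimage_id, Set.inter_univ, Function.id_comp, Function.comp_id]
  have hsub : ∀ p ∈ ((chart EB J).symm ≫ₕ chart EB J').source,
      ∃ hp : p ∈ chartTarget EB J, (chart EB J).symm p = ⟨ambientInv EB J p, ambientInv_sq J hp⟩ ∧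
        ambientInv EB J p ∈ ambientSource EB J' := by
    intro p hp
    rw [OpenPartialHomeomorph.trans_source] at hp
    have hp1 : p ∈ chartTarget EB J := hp.1
    have h2 : (chart EB J).symm p = ⟨ambientInv EB J p, ambientInv_sq J hp1⟩ := dif_pos hp1
    refine ⟨hp1, h2, ?_⟩
    have h3 : (chart EB J).symm p ∈ (chart EB J').source := hp.2
    rw [h2] at h3
    exact h3
  have h' : ContDiffOn ℝ ∞ (ambientChart EB J' ∘ ambientInv EB J)
      ((chart EB J).symm ≫ₕ chart EB J').source := by
    refine h.mono ?_
    intro p hp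
    obtain ⟨h1, -, h3⟩ := hsub p hp
    exact ⟨h1, h3⟩
  refine h'.congr ?_
  intro p hp
  obtain ⟨h1, h2, h3⟩ := hsub p hp
  change chart EB J' ((chart EB J).symm p) = _
  rw [h2]
  rfl

/-- The twistor space is smoothly mapped into `End V` by the inclusion. -/
theorem contMDiff_toEnd : ContMDiff 𝓘(ℝ, EB × TwistorModel F) (𝓘(ℝ, EB).prod 𝓘(ℝ, F →L[ℝ] F)) ∞
    (toEnd : TwistorSpace F V → EndTotal F V) := by
  intro J
  have h1 : ContMDiffOn 𝓘(ℝ, EB × TwistorModel F) 𝓘(ℝ, EB × TwistorModel F) ∞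
      (chart EB J) (chart EB J).source := contMDiffOn_chart (x := J)
  have h2 := (contMDiffOn_ambientInv (EB := EB) J).comp h1 (fun A hA => (chart EB J).map_source hA)
  refine (h2.congr fun A hA => ?_).contMDiffAt
    ((chart EB J).open_source.mem_nhds (mem_chart_source J))
  exact (ambientChart_mem_target J hA A.2).2.symm

end TwistorSpace
end TwistorSpace

section AlmostComplex

/-- An almost complex structure on `M`: a smooth section `I` of `End TM` with `I ^ 2 = -1`. -/
structure IsAlmostComplexStructure {E : Type*} [NormedAddCommGroup E] [NormedSpace ℝ E]
    {M : Type*} [TopologicalSpace M] [ChartedSpace E M] [IsManifold 𝓘(ℝ, E) ∞ M]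
    (I : ∀ x : M, TangentSpace 𝓘(ℝ, E) x →L[ℝ] TangentSpace 𝓘(ℝ, E) x) : Prop where
  smooth : ContMDiff 𝓘(ℝ, E) (𝓘(ℝ, E).prod 𝓘(ℝ, E →L[ℝ] E)) ∞
    (fun x => (⟨x, I x⟩ : EndTotal E (fun x : M => TangentSpace 𝓘(ℝ, E) x)))
  sq : ∀ x v, I x (I x v) = -v

end AlmostComplex

section Connection

variable {EB : Type*} [NormedAddCommGroup EB] [NormedSpace ℝ EB]
  {M : Type*} [TopologicalSpace M] [ChartedSpace EB M]
  {F : Type*} [NormedAddCommGroup F] [NormedSpace ℝ F]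
  {V : M → Type*} [∀ x, AddCommGroup (V x)] [∀ x, Module ℝ (V x)]
  [TopologicalSpace (TotalSpace F V)] [∀ x, TopologicalSpace (V x)]
  [FiberBundle F V] [VectorBundle ℝ F V]
  [∀ x, IsTopologicalAddGroup (V x)] [∀ x, ContinuousSMul ℝ (V x)]

/-- The covariant derivative `D s / dt` of a section `s` of `V` along a curve `γ` in the base; the
curve `s` in the total space of `V` records both. In a local frame `e_i` of the trivialization at
`γ t` and with `s = s^i e_i`, it is `(s^i)' e_i + s^i ∇_{γ'} e_i`, the second term being the
covariant derivative of the section which has constant coordinates and the value `s t` at `γ t`. -/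
def covDerivAlong (cov : CovariantDerivative 𝓘(ℝ, EB) F V) (s : ℝ → TotalSpace F V) (t : ℝ) :
    V (s t).proj :=
  (trivializationAt F V (s t).proj).symm (s t).proj
      (deriv (fun τ => (trivializationAt F V (s t).proj (s τ)).2) t) +
    cov (extend F (s t).2) (s t).proj
      (mfderiv 𝓘(ℝ, ℝ) 𝓘(ℝ, EB) (fun τ => (s τ).proj) t (1 : ℝ))

/-- A curve `c` in the total space of `End V` is parallel at time `t`: it is differentiable there
and its covariant derivative along its projection to the base vanishes there. By the Leibniz rule
`(D c / dt) s = D (c s) / dt - c (D s / dt)` for the connection induced on `End V`, the latter says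
that `D (c s) / dt = c (D s / dt)` for all sections `s` of `V` along the projected curve. -/
def IsParallelEndAt (cov : CovariantDerivative 𝓘(ℝ, EB) F V) (c : ℝ → EndTotal F V) (t : ℝ) :
    Prop :=
  MDifferentiableAt 𝓘(ℝ, ℝ) (𝓘(ℝ, EB).prod 𝓘(ℝ, F →L[ℝ] F)) c t ∧
    ∀ s : ∀ τ : ℝ, V (c τ).proj,
      MDifferentiableAt 𝓘(ℝ, ℝ) (𝓘(ℝ, EB).prod 𝓘(ℝ, F))
        (fun τ => (⟨(c τ).proj, s τ⟩ : TotalSpace F V)) t →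
      covDerivAlong cov (fun τ => (⟨(c τ).proj, (c τ).2 (s τ)⟩ : TotalSpace F V)) t =
        (c t).2 (covDerivAlong cov (fun τ => (⟨(c τ).proj, s τ⟩ : TotalSpace F V)) t)

/-- The horizontal space at `A` in the tangent space of the total space of `End V`: the velocities
at time `0` of the parallel translates of `A` along curves in the base. -/
def horizontal (cov : CovariantDerivative 𝓘(ℝ, EB) F V) (A : EndTotal F V) :
    Set (TangentSpace (𝓘(ℝ, EB).prod 𝓘(ℝ, F →L[ℝ] F)) A) :=
  {X | ∃ c : ℝ → EndTotal F V, (∀ᶠ t in 𝓝 0, IsParallelEndAt cov c t) ∧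
    (⟨c 0, mfderiv 𝓘(ℝ, ℝ) (𝓘(ℝ, EB).prod 𝓘(ℝ, F →L[ℝ] F)) c 0 (1 : ℝ)⟩ :
      TangentBundle (𝓘(ℝ, EB).prod 𝓘(ℝ, F →L[ℝ] F)) (EndTotal F V)) = ⟨A, X⟩}

/-- The vertical tangent vector at `A` given by `B ∈ End V_x`: the velocity of `A + t B`. -/
def verticalLift (A : EndTotal F V) (B : V A.proj →L[ℝ] V A.proj) :
    TangentSpace (𝓘(ℝ, EB).prod 𝓘(ℝ, F →L[ℝ] F)) A :=
  mfderiv 𝓘(ℝ, ℝ) (𝓘(ℝ, EB).prod 𝓘(ℝ, F →L[ℝ] F))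
    (fun t : ℝ => (⟨A.proj, A.2 + t • B⟩ : EndTotal F V)) 0 (1 : ℝ)

/-- The projection of the tangent space of `End V` at `A` to the vertical space along the
horizontal space, the vertical space being identified with `End V_x`: the value at `X` is the
unique `B` such that `X - B` is horizontal. -/
def endVerticalProj (cov : CovariantDerivative 𝓘(ℝ, EB) F V) (A : EndTotal F V)
    (X : TangentSpace (𝓘(ℝ, EB).prod 𝓘(ℝ, F →L[ℝ] F)) A) : V A.proj →L[ℝ] V A.proj :=
  Classical.epsilon fun B => X - verticalLift A B ∈ horizontal cov A

variable [FiniteDimensional ℝ F]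

namespace TwistorSpace

/-- The derivative `π_*` of the projection of the twistor space to the base. -/
def projDeriv (J : TwistorSpace F V) (X : TangentSpace 𝓘(ℝ, EB × TwistorModel F) J) :
    TangentSpace 𝓘(ℝ, EB) J.proj :=
  mfderiv 𝓘(ℝ, EB × TwistorModel F) 𝓘(ℝ, EB) (proj : TwistorSpace F V → M) J X

/-- The vertical projection `P` of the tangent space of the twistor space at `J`, with values
in `End V_x`. -/
def verticalProj (cov : CovariantDerivative 𝓘(ℝ, EB) F V) (J : TwistorSpace F V)
    (X : TangentSpace 𝓘(ℝ, EB × TwistorModel F) J) : V J.proj →L[ℝ] V J.proj :=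
  endVerticalProj cov J.toEnd
    (mfderiv 𝓘(ℝ, EB × TwistorModel F) (𝓘(ℝ, EB).prod 𝓘(ℝ, F →L[ℝ] F))
      (toEnd : TwistorSpace F V → EndTotal F V) J X)

/-- The almost complex structure on the twistor space which is `B ↦ J B` on the vertical space and
`v ↦ I v` on the horizontal space, identified with the tangent space of the base: the
value at `X` is the unique tangent vector with vertical part `J (P X)` and projection
`I (π_* X)`. -/
def almostComplex (cov : CovariantDerivative 𝓘(ℝ, EB) F V)
    (I : ∀ x : M, TangentSpace 𝓘(ℝ, EB) x →L[ℝ] TangentSpace 𝓘(ℝ, EB) x)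
    (J : TwistorSpace F V) (X : TangentSpace 𝓘(ℝ, EB × TwistorModel F) J) :
    TangentSpace 𝓘(ℝ, EB × TwistorModel F) J :=
  Classical.epsilon fun Z => verticalProj cov J Z = J.toEnd.2 * verticalProj cov J X ∧
    projDeriv J Z = I J.proj (projDeriv J X)

end TwistorSpace

end Connection

section Nijenhuis

variable {E : Type*} [NormedAddCommGroup E] [NormedSpace ℝ E]
  {M : Type*} [TopologicalSpace M] [ChartedSpace E M] [IsManifold 𝓘(ℝ, E) ∞ M]

/-- The Nijenhuis expression `[J X, J Y] - J [J X, Y] - J [X, J Y] - [X, Y]` of vector fields. -/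
def nijenhuisField (J : ∀ x : M, TangentSpace 𝓘(ℝ, E) x → TangentSpace 𝓘(ℝ, E) x)
    (X Y : ∀ x : M, TangentSpace 𝓘(ℝ, E) x) (x : M) : TangentSpace 𝓘(ℝ, E) x :=
  mlieBracket 𝓘(ℝ, E) (fun y => J y (X y)) (fun y => J y (Y y)) x -
    J x (mlieBracket 𝓘(ℝ, E) (fun y => J y (X y)) Y x) -
    J x (mlieBracket 𝓘(ℝ, E) X (fun y => J y (Y y)) x) - mlieBracket 𝓘(ℝ, E) X Y x

/-- The Nijenhuis tensor on tangent vectors at `x`, computed with the extensions of the vectors to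
vector fields that have constant coordinates near `x` (it does not depend on the extension). -/
def nijenhuis (J : ∀ x : M, TangentSpace 𝓘(ℝ, E) x → TangentSpace 𝓘(ℝ, E) x)
    (x : M) (v w : TangentSpace 𝓘(ℝ, E) x) : TangentSpace 𝓘(ℝ, E) x :=
  nijenhuisField J (extend E v) (extend E w) x

end Nijenhuis

section Curvature

variable {EB : Type*} [NormedAddCommGroup EB] [NormedSpace ℝ EB]
  {M : Type*} [TopologicalSpace M] [ChartedSpace EB M] [IsManifold 𝓘(ℝ, EB) ∞ M]
  {F : Type*} [NormedAddCommGroup F] [NormedSpace ℝ F]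
  {V : M → Type*} [∀ x, AddCommGroup (V x)] [∀ x, Module ℝ (V x)]
  [TopologicalSpace (TotalSpace F V)] [∀ x, TopologicalSpace (V x)]
  [FiberBundle F V] [VectorBundle ℝ F V]
  [∀ x, IsTopologicalAddGroup (V x)] [∀ x, ContinuousSMul ℝ (V x)]

/-- `∇_X ∇_Y s - ∇_Y ∇_X s - ∇_[X,Y] s` at `x`, for vector fields `X`, `Y` and a section `s`. -/
def curvatureField (cov : CovariantDerivative 𝓘(ℝ, EB) F V)
    (X Y : ∀ x : M, TangentSpace 𝓘(ℝ, EB) x) (s : ∀ x : M, V x) (x : M) : V x :=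
  cov (fun y => cov s y (Y y)) x (X x) - cov (fun y => cov s y (X y)) x (Y x) -
    cov s x (mlieBracket 𝓘(ℝ, EB) X Y x)

variable [FiniteDimensional ℝ EB] [T2Space M] [ContMDiffVectorBundle ∞ F V 𝓘(ℝ, EB)]

theorem mdifferentiableAt_cov (cov : CovariantDerivative 𝓘(ℝ, EB) F V)
    [hcov : CovariantDerivative.ContMDiffCovariantDerivative cov ∞] {x : M} {s : ∀ x : M, V x}
    (hs : ∀ᶠ y in 𝓝 x, CMDiffAt ∞ (T% s) y) {Y : ∀ x : M, TangentSpace 𝓘(ℝ, EB) x}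
    (hY : MDiffAt (T% Y) x) : MDiffAt (T% (fun y => cov s y (Y y))) x := by
  obtain ⟨u, hu, huo, hxu⟩ := eventually_nhds_iff.1 hs
  obtain ⟨f, -, hf⟩ :=
    (SmoothBumpFunction.nhds_basis_tsupport (I := 𝓘(ℝ, EB)) x).mem_iff.1 (huo.mem_nhds hxu)
  have h1 : CMDiff ∞ (T% ((f : M → ℝ) • s)) :=
    ContMDiffOn.smul_section_of_tsupport f.contMDiff.contMDiffOn huo hf
      (fun y hy => (hu y hy).contMDiffWithinAt)
  have h2 := hcov.contMDiff.contMDiff (σ := (f : M → ℝ) • s)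
    (by simpa using h1.contMDiffOn (s := Set.univ))
  have h3 := (h2.contMDiffAt (x := x) Filter.univ_mem).mdifferentiableAt (by simp)
  have h4 : MDiffAt (T% (fun y => cov ((f : M → ℝ) • s) y (Y y))) x :=
    MDifferentiableAt.clm_bundle_apply h3 hY
  refine h4.congr_of_eventuallyEq ?_
  filter_upwards [f.eventuallyEq_one.eventuallyEq_nhds, huo.mem_nhds hxu] with y hy hyu
  have : cov s y = cov ((f : M → ℝ) • s) y := by
    refine cov.isCovariantDerivativeOn.congr_of_eventuallyEq (s := Set.univ)
      ((hu y hyu).mdifferentiableAt (by simp)) ((h1 y).mdifferentiableAt (by simp))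
      Filter.univ_mem ?_
    filter_upwards [hy] with z hz
    simp [hz]
  simp [this]

theorem cov_add_eventually (cov : CovariantDerivative 𝓘(ℝ, EB) F V)
    [CovariantDerivative.ContMDiffCovariantDerivative cov ∞] {x : M} {s s' : ∀ x : M, V x}
    (hs : ∀ᶠ y in 𝓝 x, CMDiffAt ∞ (T% s) y) (hs' : ∀ᶠ y in 𝓝 x, CMDiffAt ∞ (T% s') y)
    {Y : ∀ x : M, TangentSpace 𝓘(ℝ, EB) x} (hY : MDiffAt (T% Y) x) :
    cov (fun y => cov (s + s') y (Y y)) x =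
      cov (fun y => cov s y (Y y)) x + cov (fun y => cov s' y (Y y)) x := by
  have h1 := mdifferentiableAt_cov cov hs hY
  have h2 := mdifferentiableAt_cov cov hs' hY
  rw [← cov.isCovariantDerivativeOn.add (s := Set.univ) h1 h2]
  have h12 : ∀ᶠ y in 𝓝 x, CMDiffAt ∞ (T% (s + s')) y := by
    filter_upwards [hs, hs'] with y hy hy' using hy.add_section hy'
  refine cov.isCovariantDerivativeOn.congr_of_eventuallyEq (s := Set.univ)
    (mdifferentiableAt_cov cov h12 hY) (mdifferentiableAt_add_section h1 h2) Filter.univ_mem ?_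
  filter_upwards [hs, hs'] with y hy hy'
  rw [cov.isCovariantDerivativeOn.add (s := Set.univ) (hy.mdifferentiableAt (by simp))
    (hy'.mdifferentiableAt (by simp))]
  rfl

theorem cov_smul_eventually (cov : CovariantDerivative 𝓘(ℝ, EB) F V)
    [CovariantDerivative.ContMDiffCovariantDerivative cov ∞] {x : M} (r : ℝ) {s : ∀ x : M, V x}
    (hs : ∀ᶠ y in 𝓝 x, CMDiffAt ∞ (T% s) y)
    {Y : ∀ x : M, TangentSpace 𝓘(ℝ, EB) x} (hY : MDiffAt (T% Y) x) :
    cov (fun y => cov (r • s) y (Y y)) x = r • cov (fun y => cov s y (Y y)) x := by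
  have h1 := mdifferentiableAt_cov cov hs hY
  rw [← cov.isCovariantDerivativeOn.smul_const (s := Set.univ) r h1]
  have h12 : ∀ᶠ y in 𝓝 x, CMDiffAt ∞ (T% (r • s)) y := by
    filter_upwards [hs] with y hy using hy.const_smul_section
  refine cov.isCovariantDerivativeOn.congr_of_eventuallyEq (s := Set.univ)
    (mdifferentiableAt_cov cov h12 hY)
    (mdifferentiableAt_const.smul_section h1) Filter.univ_mem ?_
  filter_upwards [hs] with y hy
  rw [cov.isCovariantDerivativeOn.smul_const (s := Set.univ) r (hy.mdifferentiableAt (by simp))]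
  rfl

theorem contMDiffAt_extend_eventually {x : M} (e : V x) :
    ∀ᶠ y in 𝓝 x, CMDiffAt ∞ (T% (extend F e)) y := by
  obtain ⟨u, hu, hs⟩ := exists_contMDiffOn_extend (k := ∞) 𝓘(ℝ, EB) F e
  filter_upwards [eventually_mem_nhds_iff.2 hu] with y hy
  exact hs.contMDiffAt hy

theorem extend_add_eventually {x : M} (e e' : V x) :
    ∀ᶠ y in 𝓝 x, extend F (e + e') y = (extend F e + extend F e') y := by
  have hb := mem_baseSet_trivializationAt F V x
  filter_upwards [(trivializationAt F V x).open_baseSet.mem_nhds hb] with y hy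
  simp only [extend, Pi.add_apply]
  rw [((trivializationAt F V x).linear ℝ hb).map_add]
  simp only [← Trivialization.coe_symmₗ (R := ℝ) _ hy, map_add]

theorem extend_smul_eventually {x : M} (r : ℝ) (e : V x) :
    ∀ᶠ y in 𝓝 x, extend F (r • e) y = (r • extend F e) y := by
  have hb := mem_baseSet_trivializationAt F V x
  filter_upwards [(trivializationAt F V x).open_baseSet.mem_nhds hb] with y hy
  simp only [extend, Pi.smul_apply]
  rw [((trivializationAt F V x).linear ℝ hb).map_smul]
  simp only [← Trivialization.coe_symmₗ (R := ℝ) _ hy, map_smul]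

theorem curvatureField_congr (cov : CovariantDerivative 𝓘(ℝ, EB) F V)
    [CovariantDerivative.ContMDiffCovariantDerivative cov ∞] {x : M} {s s' : ∀ x : M, V x}
    (hs : ∀ᶠ y in 𝓝 x, CMDiffAt ∞ (T% s) y) (hs' : ∀ᶠ y in 𝓝 x, CMDiffAt ∞ (T% s') y)
    (h : ∀ᶠ y in 𝓝 x, s y = s' y) {X Y : ∀ x : M, TangentSpace 𝓘(ℝ, EB) x}
    (hX : MDiffAt (T% X) x) (hY : MDiffAt (T% Y) x) :
    curvatureField cov X Y s x = curvatureField cov X Y s' x := by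
  have h1 : ∀ᶠ y in 𝓝 x, cov s y = cov s' y := by
    filter_upwards [hs, hs', h.eventually_nhds] with y hy hy' hyy
    exact cov.isCovariantDerivativeOn.congr_of_eventuallyEq (s := Set.univ)
      (hy.mdifferentiableAt (by simp)) (hy'.mdifferentiableAt (by simp)) Filter.univ_mem hyy
  have h2 {Z : ∀ x : M, TangentSpace 𝓘(ℝ, EB) x} (hZ : MDiffAt (T% Z) x) :
      cov (fun y => cov s y (Z y)) x = cov (fun y => cov s' y (Z y)) x := by
    refine cov.isCovariantDerivativeOn.congr_of_eventuallyEq (s := Set.univ)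
      (mdifferentiableAt_cov cov hs hZ) (mdifferentiableAt_cov cov hs' hZ) Filter.univ_mem ?_
    filter_upwards [h1] with y hy
    rw [hy]
  unfold curvatureField
  rw [h2 hX, h2 hY, h1.self_of_nhds]

variable [FiniteDimensional ℝ F]

/-- The curvature `R(v, w) ∈ End V_x` of a smooth connection, with
`R(X, Y) = ∇_X ∇_Y - ∇_Y ∇_X - ∇_[X,Y]`, computed with the extensions of `v`, `w` and of the
argument that have constant coordinates near `x` (it does not depend on the extensions). -/
def curvature (cov : CovariantDerivative 𝓘(ℝ, EB) F V) [CovariantDerivative.ContMDiffCovariantDerivative cov ∞]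
    (x : M) (v w : TangentSpace 𝓘(ℝ, EB) x) : V x →L[ℝ] V x :=
  have : FiniteDimensional ℝ (V x) := VectorBundle.finiteDimensional ℝ F V x
  have : T2Space (V x) := FiberBundle.t2Space F V x
  LinearMap.toContinuousLinearMap
    { toFun := fun e => curvatureField cov (extend EB v) (extend EB w) (extend F e) x
      map_add' := fun e e' => by
        have h := contMDiffAt_extend_eventually (EB := EB) (F := F) e
        have h' := contMDiffAt_extend_eventually (EB := EB) (F := F) e'
        have hv := mdifferentiableAt_extend 𝓘(ℝ, EB) EB v
        have hw := mdifferentiableAt_extend 𝓘(ℝ, EB) EB w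
        rw [curvatureField_congr cov (contMDiffAt_extend_eventually (EB := EB) (F := F) (e + e'))
          (by filter_upwards [h, h'] with y hy hy' using hy.add_section hy')
          (extend_add_eventually e e') hv hw]
        unfold curvatureField
        rw [cov_add_eventually cov h h' hv, cov_add_eventually cov h h' hw,
          cov.isCovariantDerivativeOn.add (s := Set.univ)
            (h.self_of_nhds.mdifferentiableAt (by simp))
            (h'.self_of_nhds.mdifferentiableAt (by simp))]
        simp only [add_apply]
        abel
      map_smul' := fun r e => by
        have h := contMDiffAt_extend_eventually (EB := EB) (F := F) e
        have hv := mdifferentiableAt_extend 𝓘(ℝ, EB) EB v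
        have hw := mdifferentiableAt_extend 𝓘(ℝ, EB) EB w
        rw [curvatureField_congr cov (contMDiffAt_extend_eventually (EB := EB) (F := F) (r • e))
          (by filter_upwards [h] with y hy using hy.const_smul_section)
          (extend_smul_eventually r e) hv hw]
        unfold curvatureField
        rw [cov_smul_eventually cov r h hv, cov_smul_eventually cov r h hw,
          cov.isCovariantDerivativeOn.smul_const (s := Set.univ) r
            (h.self_of_nhds.mdifferentiableAt (by simp))]
        simp only [smul_apply, RingHom.id_apply, smul_sub] }

end Curvature
end

/-!
The theorem is local. The chart of `M` at `x₀ = π J` and the trivialization of `V` there identify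
the total space of `End V` near `J` with an open subset of `EB × End F`. On the twistor space this
becomes the Cayley parametrization `twistorParam`, an immersion whose tangent spaces are
`{(u, b) | b a + a b = 0}`. The inclusion is what makes the computation short: it takes place on
`EB × End F`, where the vertical projection and the complex structure have polynomial formulas,
rather than in a chart of the twistor space.

* If `Γ` is the connection form, a curve `(x, a)` in `EB × End F` is parallel if and only if
  `a' + [Γ x', a] = 0` (`isParallelEndAt_iff`). By the existence theorem for ordinary differential
  equations the horizontal space at `(x, a)` is therefore the kernel of
  `(u, b) ↦ b + [Γ u, a]` (`mem_horizontal_iff`), and this map is the vertical projection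
  (`endCoord_endVerticalProj`).
* Hence the almost complex structure is the restriction of the field `modelComplex` of endomorphisms
  of `EB × End F` (`TwistorSpace.chartDeriv_almostComplex`), which maps `(u, b)` to the vector with
  projection `I u` and vertical part `a (b + [Γ u, a])`. Its definition by a choice operator is
  unambiguous, because a tangent vector is determined by its projection and its vertical part.
* The Nijenhuis tensor is computed in charts (`nijenhuis_eq_modelNijenhuis`) and is natural for maps
  whose differential intertwines two fields of endomorphisms (`modelNijenhuis_related`). It may
  thus be evaluated for `modelComplex`. This is an algebraic identity,
  `modelNijenhuis_modelComplex`, that uses `a ^ 2 = -1` and `b a + a b = 0`; the derivatives of `Γ`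
  enter only through `dΓ + Γ ∧ Γ`, and the derivatives of `I` do not enter the vertical part.
* Finally, `dΓ + Γ ∧ Γ` is the curvature (`coord_curvature`).
-/

noncomputable section

/-! ### The Nijenhuis expression on a normed space -/

section ModelNijenhuis

variable {E : Type*} [NormedAddCommGroup E] [NormedSpace ℝ E]
  {E' : Type*} [NormedAddCommGroup E'] [NormedSpace ℝ E']

/-- The Nijenhuis expression at `p` of a field `K` of endomorphisms of a normed space, on vectors
`X` and `Y`; it is the Nijenhuis expression of the constant vector fields `X` and `Y`. -/
def modelNijenhuis (K : E → E →L[ℝ] E) (p X Y : E) : E :=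
  fderiv ℝ K p (K p X) Y - fderiv ℝ K p (K p Y) X + K p (fderiv ℝ K p Y X) -
    K p (fderiv ℝ K p X Y)

/-- The Nijenhuis expression is natural: if the differential of `f` intertwines `K` and `K'`, it
intertwines their Nijenhuis expressions, because the second derivative of `f` is symmetric. -/
theorem modelNijenhuis_related {f : E → E'} {K : E → E →L[ℝ] E} {K' : E' → E' →L[ℝ] E'} {p : E}
    (hf : ContDiffAt ℝ 2 f p) (hK : DifferentiableAt ℝ K p) (hK' : DifferentiableAt ℝ K' (f p))
    (h : ∀ᶠ q in 𝓝 p, ∀ X, fderiv ℝ f q (K q X) = K' (f q) (fderiv ℝ f q X)) (X Y : E) :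
    fderiv ℝ f p (modelNijenhuis K p X Y) =
      modelNijenhuis K' (f p) (fderiv ℝ f p X) (fderiv ℝ f p Y) := by
  have hf1 : DifferentiableAt ℝ f p := hf.differentiableAt (by simp)
  have hf2 : DifferentiableAt ℝ (fderiv ℝ f) p :=
    (hf.fderiv_right (m := 1) (by norm_num)).differentiableAt (by simp)
  have hsymm : IsSymmSndFDerivAt ℝ f p := hf.isSymmSndFDerivAt (by simp)
  have h0 := h.self_of_nhds
  -- the derivative in direction `U` of the intertwining relation applied to the constant `X`
  have key (X U : E) : fderiv ℝ (fderiv ℝ f) p U (K p X) + fderiv ℝ f p (fderiv ℝ K p U X) =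
      fderiv ℝ K' (f p) (fderiv ℝ f p U) (fderiv ℝ f p X) +
        K' (f p) (fderiv ℝ (fderiv ℝ f) p U X) := by
    have h1 : HasFDerivAt (fun q => fderiv ℝ f q (K q X)) _ p :=
      hf2.hasFDerivAt.clm_apply (hK.hasFDerivAt.clm_apply (hasFDerivAt_const X p))
    have h2 : HasFDerivAt (fun q => K' (f q) (fderiv ℝ f q X)) _ p :=
      (hK'.hasFDerivAt.comp p hf1.hasFDerivAt).clm_apply
        (hf2.hasFDerivAt.clm_apply (hasFDerivAt_const X p))
    have h3 := h2.congr_of_eventuallyEq (h.mono fun q hq => hq X)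
    have := congr($(h1.unique h3) U)
    simpa [add_comm] using this
  have e1 := key Y (K p X)
  have e2 := key X (K p Y)
  have e3 := congr(K' (f p) $(key X Y))
  have e4 := congr(K' (f p) $(key Y X))
  rw [hsymm.eq (K p X) (K p Y), h0, hsymm.eq (K p X) Y] at e1
  rw [h0, hsymm.eq (K p Y) X] at e2
  rw [hsymm.eq Y X] at e3
  simp only [map_add] at e3 e4
  simp only [modelNijenhuis, map_sub, map_add, h0]
  linear_combination (norm := module) e1 - e2 + e3 - e4

end ModelNijenhuis

/-! ### Lie brackets and Nijenhuis tensors in a chart -/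

section ChartNijenhuis

variable {E : Type*} [NormedAddCommGroup E] [NormedSpace ℝ E]
  {M : Type*} [TopologicalSpace M] [ChartedSpace E M] [IsManifold 𝓘(ℝ, E) ∞ M]

/-- The differential at `y` of the preferred chart at `x₀`, with values in the model space. -/
def chartDeriv (x₀ y : M) : TangentSpace 𝓘(ℝ, E) y →L[ℝ] E :=
  mfderiv 𝓘(ℝ, E) 𝓘(ℝ, E) (extChartAt 𝓘(ℝ, E) x₀) y

theorem chartDeriv_self (x₀ : M) (v : TangentSpace 𝓘(ℝ, E) x₀) :
    chartDeriv x₀ x₀ v = v := by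
  have : IsManifold 𝓘(ℝ, E) 1 M := .of_le (n := ∞) (by simp)
  rw [chartDeriv, mfderiv_extChartAt_self]
  rfl

theorem chartDeriv_bijective {x₀ y : M} (hy : y ∈ (chartAt E x₀).source) :
    Function.Bijective (chartDeriv (E := E) x₀ y) := by
  have : IsManifold 𝓘(ℝ, E) 1 M := .of_le (n := ∞) (by simp)
  exact (isInvertible_mfderiv_extChartAt (I := 𝓘(ℝ, E)) (by simpa using hy)).bijective

theorem chartDeriv_eq_trivialization {x₀ y : M} (hy : y ∈ (chartAt E x₀).source)
    (v : TangentSpace 𝓘(ℝ, E) y) :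
    (trivializationAt E (TangentSpace 𝓘(ℝ, E)) x₀ ⟨y, v⟩).2 = chartDeriv x₀ y v := by
  have : IsManifold 𝓘(ℝ, E) 1 M := .of_le (n := ∞) (by simp)
  have h := TangentBundle.continuousLinearMapAt_trivializationAt (I := 𝓘(ℝ, E)) hy
  rw [chartDeriv, ← h]
  rw [Trivialization.continuousLinearMapAt_apply, Trivialization.linearMapAt_apply,
    if_pos (by simpa using hy)]

theorem chartDeriv_extend {x₀ y : M} (hy : y ∈ (chartAt E x₀).source)
    (v : TangentSpace 𝓘(ℝ, E) x₀) :
    chartDeriv x₀ y (extend E v y) = v := by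
  rw [← chartDeriv_eq_trivialization hy, extend,
    Trivialization.apply_mk_symm _ (by simpa using hy),
    chartDeriv_eq_trivialization (mem_chart_source E x₀), chartDeriv_self]

/-- The Lie bracket of vector fields computed in the preferred chart. -/
theorem mlieBracket_eq_of_chart [CompleteSpace E] {x₀ : M}
    {X Y : ∀ x : M, TangentSpace 𝓘(ℝ, E) x} {X' Y' : E → E}
    (hX : ∀ᶠ y in 𝓝 x₀, chartDeriv x₀ y (X y) = X' (chartAt E x₀ y))
    (hY : ∀ᶠ y in 𝓝 x₀, chartDeriv x₀ y (Y y) = Y' (chartAt E x₀ y)) :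
    mlieBracket 𝓘(ℝ, E) X Y x₀ =
      fderiv ℝ Y' (chartAt E x₀ x₀) (X' (chartAt E x₀ x₀)) -
        fderiv ℝ X' (chartAt E x₀ x₀) (Y' (chartAt E x₀ x₀)) := by
  have : IsManifold 𝓘(ℝ, E) 1 M := .of_le (n := ∞) (by simp)
  -- pulled back by the inverse chart, `X` becomes `X'`
  have key {X : ∀ x : M, TangentSpace 𝓘(ℝ, E) x} {X' : E → E}
      (hX : ∀ᶠ y in 𝓝 x₀, chartDeriv x₀ y (X y) = X' (chartAt E x₀ y)) :
      ∀ᶠ p in 𝓝 (chartAt E x₀ x₀), (mpullbackWithin 𝓘(ℝ, E) 𝓘(ℝ, E)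
        (extChartAt 𝓘(ℝ, E) x₀).symm X (Set.range 𝓘(ℝ, E)) p : E) = X' p := by
    have h1 := (continuousAt_extChartAt_symm (I := 𝓘(ℝ, E)) x₀).eventually
      (by rwa [extChartAt_to_inv])
    have h2 := extChartAt_target_mem_nhds (I := 𝓘(ℝ, E)) x₀
    have h3 : extChartAt 𝓘(ℝ, E) x₀ x₀ = chartAt E x₀ x₀ := rfl
    rw [h3] at h1 h2
    filter_upwards [h1, h2] with p hp hp2
    have h4 := mfderiv_extChartAt_comp_mfderivWithin_extChartAt_symm hp2
    have h5 := mfderivWithin_extChartAt_symm_comp_mfderiv_extChartAt hp2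
    have h6 : chartAt E x₀ ((extChartAt 𝓘(ℝ, E) x₀).symm p) = p :=
      (extChartAt 𝓘(ℝ, E) x₀).right_inv hp2
    rw [h6] at hp
    rw [mpullbackWithin_apply, ← hp, ContinuousLinearMap.inverse_eq h5 h4]
    rfl
  have h7 : (mfderiv 𝓘(ℝ, E) 𝓘(ℝ, E) (extChartAt 𝓘(ℝ, E) x₀) x₀).inverse =
      ContinuousLinearMap.id ℝ _ := by
    rw [mfderiv_extChartAt_self]
    exact ContinuousLinearMap.inverse_id
  rw [← mlieBracketWithin_univ, mlieBracketWithin_apply, h7]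
  have h8 := Filter.EventuallyEq.lieBracket_vectorField_eq (𝕜 := ℝ) (key hX) (key hY)
  have hr : (extChartAt 𝓘(ℝ, E) x₀).symm ⁻¹' Set.univ ∩ Set.range 𝓘(ℝ, E) = Set.univ := by simp
  rw [hr]
  exact (congrFun (lieBracketWithin_univ (𝕜 := ℝ) (E := E)) _).trans h8

/-- The Nijenhuis tensor computed in the preferred chart. -/
theorem nijenhuis_eq_modelNijenhuis [CompleteSpace E] {x₀ : M}
    {K : ∀ x : M, TangentSpace 𝓘(ℝ, E) x → TangentSpace 𝓘(ℝ, E) x} {K' : E → E →L[ℝ] E}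
    (hK' : DifferentiableAt ℝ K' (chartAt E x₀ x₀))
    (h : ∀ᶠ y in 𝓝 x₀, ∀ v, chartDeriv x₀ y (K y v) = K' (chartAt E x₀ y) (chartDeriv x₀ y v))
    (v w : TangentSpace 𝓘(ℝ, E) x₀) :
    nijenhuis K x₀ v w = modelNijenhuis K' (chartAt E x₀ x₀) v w := by
  -- the tangent space at `x₀` is identified with the model space `E`
  suffices H : ∀ v w : E, (nijenhuis K x₀ v w : E) = modelNijenhuis K' (chartAt E x₀ x₀) v w from
    H v w
  clear v w
  intro v w
  have hsrc := (chartAt E x₀).open_source.mem_nhds (mem_chart_source E x₀)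
  let ext (v : E) : ∀ y : M, TangentSpace 𝓘(ℝ, E) y :=
    extend (E := fun x : M => TangentSpace 𝓘(ℝ, E) x) (x := x₀) E v
  let Kext (v : E) : ∀ y : M, TangentSpace 𝓘(ℝ, E) y := fun y => K y (ext v y)
  have h1 (v : E) : ∀ᶠ y in 𝓝 x₀, chartDeriv x₀ y (ext v y) = (fun _ => v) (chartAt E x₀ y) := by
    filter_upwards [hsrc] with y hy using chartDeriv_extend hy v
  have h2 (v : E) : ∀ᶠ y in 𝓝 x₀,
      chartDeriv x₀ y (Kext v y) = (fun p => K' p v) (chartAt E x₀ y) := by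
    filter_upwards [h1 v, h] with y hy hy2
    rw [hy2, hy]
  have h0 (v : E) : (K x₀ v : E) = K' (chartAt E x₀ x₀) v := by
    have := h.self_of_nhds v
    rw [chartDeriv_self] at this
    exact this.trans (congrArg _ (chartDeriv_self x₀ v))
  have hd (v u : E) : fderiv ℝ (fun p => K' p v) (chartAt E x₀ x₀) u =
      fderiv ℝ K' (chartAt E x₀ x₀) u v := by
    rw [fderiv_clm_apply hK' (differentiableAt_const v)]
    simp
  have b1 := mlieBracket_eq_of_chart (X := Kext v) (Y := Kext w) (X' := fun p => K' p v)
    (Y' := fun p => K' p w) (h2 v) (h2 w)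
  have b2 := mlieBracket_eq_of_chart (X := Kext v) (Y := ext w) (X' := fun p => K' p v)
    (Y' := fun _ => w) (h2 v) (h1 w)
  have b3 := mlieBracket_eq_of_chart (X := ext v) (Y := Kext w) (X' := fun _ => v)
    (Y' := fun p => K' p w) (h1 v) (h2 w)
  have b4 := mlieBracket_eq_of_chart (X := ext v) (Y := ext w) (X' := fun _ => v)
    (Y' := fun _ => w) (h1 v) (h1 w)
  simp only [hd, fderiv_fun_const, Pi.zero_apply, zero_apply, zero_sub, sub_zero] at b1 b2 b3 b4
  have hN : nijenhuis K x₀ v w = mlieBracket 𝓘(ℝ, E) (Kext v) (Kext w) x₀ -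
    K x₀ (mlieBracket 𝓘(ℝ, E) (Kext v) (ext w) x₀) -
    K x₀ (mlieBracket 𝓘(ℝ, E) (ext v) (Kext w) x₀) - mlieBracket 𝓘(ℝ, E) (ext v) (ext w) x₀ := rfl
  rw [hN, b1, b2, b3, b4, h0, h0, modelNijenhuis, map_neg]
  exact (fun a b c d => by abel : ∀ a b c d : E, a - b - -c - d - 0 = a - b + c - d) _ _ _ _

end ChartNijenhuis

/-! ### The twistor complex structure on a trivial bundle -/

section ModelTwistor

variable {E : Type*} [NormedAddCommGroup E] [NormedSpace ℝ E]
  {𝔸 : Type*} [NormedRing 𝔸] [NormedAlgebra ℝ 𝔸]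

/-- The commutator `u ↦ [Γ x u, a]`: in a trivialization with connection form `Γ`, the horizontal
lift of `u` at the endomorphism `a` over `x` is `(u, -[Γ x u, a])`. -/
def connBracket (Γ : E → E →L[ℝ] 𝔸) (p : E × 𝔸) : E →L[ℝ] 𝔸 :=
  ((ContinuousLinearMap.mul ℝ 𝔸).flip p.2 - ContinuousLinearMap.mul ℝ 𝔸 p.2) ∘L Γ p.1

theorem connBracket_apply (Γ : E → E →L[ℝ] 𝔸) (p : E × 𝔸) (u : E) :
    connBracket Γ p u = Γ p.1 u * p.2 - p.2 * Γ p.1 u := by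
  simp [connBracket]

/-- The vertical projection at `p` in a trivialization with connection form `Γ`. -/
def modelVert (Γ : E → E →L[ℝ] 𝔸) (p : E × 𝔸) : E × 𝔸 →L[ℝ] 𝔸 :=
  ContinuousLinearMap.snd ℝ E 𝔸 + connBracket Γ p ∘L ContinuousLinearMap.fst ℝ E 𝔸

theorem modelVert_apply (Γ : E → E →L[ℝ] 𝔸) (p X : E × 𝔸) :
    modelVert Γ p X = X.2 + (Γ p.1 X.1 * p.2 - p.2 * Γ p.1 X.1) := by
  simp [modelVert, connBracket_apply]

/-- The almost complex structure of the twistor space in a trivialization with connection form `Γ`,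
extended to all endomorphisms: the endomorphism of the tangent space at `(x, a)` which is left
multiplication by `a` on vertical vectors and the lift of `I x` on horizontal vectors. -/
def modelComplex (I : E → E →L[ℝ] E) (Γ : E → E →L[ℝ] 𝔸) (p : E × 𝔸) :
    E × 𝔸 →L[ℝ] E × 𝔸 :=
  ContinuousLinearMap.inl ℝ E 𝔸 ∘L I p.1 ∘L ContinuousLinearMap.fst ℝ E 𝔸 +
    ContinuousLinearMap.inr ℝ E 𝔸 ∘L (ContinuousLinearMap.mul ℝ 𝔸 p.2 ∘L modelVert Γ p -
      connBracket Γ p ∘L I p.1 ∘L ContinuousLinearMap.fst ℝ E 𝔸)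

theorem modelComplex_apply (I : E → E →L[ℝ] E) (Γ : E → E →L[ℝ] 𝔸) (p X : E × 𝔸) :
    modelComplex I Γ p X = (I p.1 X.1, p.2 * (X.2 + (Γ p.1 X.1 * p.2 - p.2 * Γ p.1 X.1)) -
      (Γ p.1 (I p.1 X.1) * p.2 - p.2 * Γ p.1 (I p.1 X.1))) := by
  simp [modelComplex, connBracket_apply, modelVert_apply]

theorem modelVert_modelComplex (I : E → E →L[ℝ] E) (Γ : E → E →L[ℝ] 𝔸) (p X : E × 𝔸) :
    modelVert Γ p (modelComplex I Γ p X) = p.2 * modelVert Γ p X := by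
  simp [modelComplex_apply, modelVert_apply]

theorem eq_modelComplex {I : E → E →L[ℝ] E} {Γ : E → E →L[ℝ] 𝔸} {p X Z : E × 𝔸}
    (h1 : Z.1 = I p.1 X.1) (h2 : modelVert Γ p Z = p.2 * modelVert Γ p X) :
    Z = modelComplex I Γ p X := by
  rw [modelVert_apply, modelVert_apply, ← eq_sub_iff_add_eq, h1] at h2
  rw [modelComplex_apply]
  exact Prod.ext h1 h2

theorem contDiffAt_modelComplex {n : WithTop ℕ∞} {I : E → E →L[ℝ] E} {Γ : E → E →L[ℝ] 𝔸}
    {p : E × 𝔸} (hI : ContDiffAt ℝ n I p.1) (hΓ : ContDiffAt ℝ n Γ p.1) :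
    ContDiffAt ℝ n (modelComplex I Γ) p := by
  have hI' : ContDiffAt ℝ n (fun q : E × 𝔸 => I q.1) p := hI.comp p contDiffAt_fst
  have hΓ' : ContDiffAt ℝ n (fun q : E × 𝔸 => Γ q.1) p := hΓ.comp p contDiffAt_fst
  have h1 : ContDiffAt ℝ n (connBracket Γ) p := by
    unfold connBracket
    fun_prop
  have h2 : ContDiffAt ℝ n (modelVert Γ) p := by
    unfold modelVert
    fun_prop
  unfold modelComplex
  fun_prop

theorem fderiv_modelComplex {I : E → E →L[ℝ] E} {Γ : E → E →L[ℝ] 𝔸} {p : E × 𝔸}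
    (hI : DifferentiableAt ℝ I p.1) (hΓ : DifferentiableAt ℝ Γ p.1)
    (hJ : DifferentiableAt ℝ (modelComplex I Γ) p) (U X : E × 𝔸) :
    fderiv ℝ (modelComplex I Γ) p U X = (fderiv ℝ I p.1 U.1 X.1,
      U.2 * modelVert Γ p X + p.2 * (fderiv ℝ Γ p.1 U.1 X.1 * p.2 + Γ p.1 X.1 * U.2
        - U.2 * Γ p.1 X.1 - p.2 * fderiv ℝ Γ p.1 U.1 X.1) -
      ((fderiv ℝ Γ p.1 U.1 (I p.1 X.1) + Γ p.1 (fderiv ℝ I p.1 U.1 X.1)) * p.2 +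
        Γ p.1 (I p.1 X.1) * U.2 - U.2 * Γ p.1 (I p.1 X.1) -
        p.2 * (fderiv ℝ Γ p.1 U.1 (I p.1 X.1) + Γ p.1 (fderiv ℝ I p.1 U.1 X.1)))) := by
  have hl : fderiv ℝ (modelComplex I Γ) p U X = fderiv ℝ (fun q => modelComplex I Γ q X) p U := by
    rw [fderiv_clm_apply hJ (differentiableAt_const X)]
    simp
  have hf := hasFDerivAt_fst (𝕜 := ℝ) (p := p)
  have hs := hasFDerivAt_snd (𝕜 := ℝ) (p := p)
  have h1 : HasFDerivAt (fun q : E × 𝔸 => I q.1 X.1) _ p :=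
    (hI.hasFDerivAt.comp p hf).clm_apply (hasFDerivAt_const X.1 p)
  have hΓ' : HasFDerivAt (fun q : E × 𝔸 => Γ q.1) _ p := hΓ.hasFDerivAt.comp p hf
  have h2 := hΓ'.clm_apply (hasFDerivAt_const X.1 p)
  have h3 := hΓ'.clm_apply h1
  have h4 := h1.prodMk ((hs.mul' (((hasFDerivAt_const X.2 p).add
    ((h2.mul' hs).sub (hs.mul' h2))))).sub ((h3.mul' hs).sub (hs.mul' h3)))
  have h5 := h4.congr_of_eventuallyEq (.of_forall fun q => modelComplex_apply I Γ q X)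
  rw [hl, h5.fderiv]
  simp [modelVert_apply]
  noncomm_ring

/-- The horizontal and the vertical part of the Nijenhuis tensor of the twistor space in a
trivialization: the vertical part involves `I` only through its values, and is expressed by the
curvature `dΓ + Γ ∧ Γ`. -/
theorem modelNijenhuis_modelComplex {I : E → E →L[ℝ] E} {Γ : E → E →L[ℝ] 𝔸} {p : E × 𝔸}
    (hI : ContDiffAt ℝ 1 I p.1) (hΓ : ContDiffAt ℝ 1 Γ p.1) (hp : p.2 * p.2 = -1)
    {X Y : E × 𝔸} (hX : X.2 * p.2 + p.2 * X.2 = 0) (hY : Y.2 * p.2 + p.2 * Y.2 = 0)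
    {R : E → E → 𝔸} (hR : ∀ u v, R u v = fderiv ℝ Γ p.1 u v - fderiv ℝ Γ p.1 v u +
      (Γ p.1 u * Γ p.1 v - Γ p.1 v * Γ p.1 u)) :
    (modelNijenhuis (modelComplex I Γ) p X Y).1 = modelNijenhuis I p.1 X.1 Y.1 ∧
      modelVert Γ p (modelNijenhuis (modelComplex I Γ) p X Y) =
        ⁅R X.1 Y.1 - R (I p.1 X.1) (I p.1 Y.1), p.2⁆ +
          p.2 * ⁅R (I p.1 X.1) Y.1 + R X.1 (I p.1 Y.1), p.2⁆ := by
  have hJ := (contDiffAt_modelComplex (n := 1) hI hΓ).differentiableAt (by simp)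
  have hI' := hI.differentiableAt (by simp)
  have hΓ' := hΓ.differentiableAt (by simp)
  obtain ⟨x, a⟩ := p
  obtain ⟨v, b⟩ := X
  obtain ⟨w, c⟩ := Y
  have ha (z : 𝔸) : a * (a * z) = -z := by rw [← mul_assoc, hp, neg_one_mul]
  have hb : b * a = -(a * b) := eq_neg_of_add_eq_zero_left hX
  have hc : c * a = -(a * c) := eq_neg_of_add_eq_zero_left hY
  have hb' (z : 𝔸) : b * (a * z) = -(a * (b * z)) := by rw [← mul_assoc, hb, neg_mul, mul_assoc]
  have hc' (z : 𝔸) : c * (a * z) = -(a * (c * z)) := by rw [← mul_assoc, hc, neg_mul, mul_assoc]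
  simp only [modelNijenhuis, fderiv_modelComplex hI' hΓ' hJ, modelComplex_apply, modelVert_apply]
  refine ⟨by simp, ?_⟩
  simp only [Prod.fst_sub, Prod.snd_sub, Prod.fst_add, Prod.snd_add, hR, Ring.lie_def, map_add,
    map_sub]
  simp only [mul_add, add_mul, mul_sub, sub_mul, mul_assoc, ha, hb', hc', mul_neg,
    neg_mul, neg_neg]
  abel

end ModelTwistor

/-! ### Connections and curvature in a trivialization -/

section LocalConnection

variable {EB : Type*} [NormedAddCommGroup EB] [NormedSpace ℝ EB]
  {M : Type*} [TopologicalSpace M] [ChartedSpace EB M] [IsManifold 𝓘(ℝ, EB) ∞ M]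
  {F : Type*} [NormedAddCommGroup F] [NormedSpace ℝ F]
  {V : M → Type*} [∀ x, AddCommGroup (V x)] [∀ x, Module ℝ (V x)]
  [TopologicalSpace (TotalSpace F V)] [∀ x, TopologicalSpace (V x)]
  [FiberBundle F V] [VectorBundle ℝ F V]
  [∀ x, IsTopologicalAddGroup (V x)] [∀ x, ContinuousSMul ℝ (V x)]

/-- The points over which both the preferred chart and the preferred trivialization at `x₀` are
defined. -/
def localDomain (F : Type*) [NormedAddCommGroup F] [NormedSpace ℝ F] (V : M → Type*)
    [∀ x, AddCommGroup (V x)] [∀ x, Module ℝ (V x)]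
    [TopologicalSpace (TotalSpace F V)] [∀ x, TopologicalSpace (V x)] [FiberBundle F V]
    (EB : Type*) [NormedAddCommGroup EB] [NormedSpace ℝ EB] [ChartedSpace EB M]
    (x₀ : M) : Set M :=
  (chartAt EB x₀).source ∩ (trivializationAt F V x₀).baseSet

theorem isOpen_localDomain (x₀ : M) : IsOpen (localDomain F V EB x₀) :=
  (chartAt EB x₀).open_source.inter (trivializationAt F V x₀).open_baseSet

theorem mem_localDomain_self (x₀ : M) : x₀ ∈ localDomain F V EB x₀ :=
  ⟨mem_chart_source EB x₀, mem_baseSet_trivializationAt F V x₀⟩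

/-- The coordinates on the fibre over `y` given by the preferred trivialization at `x₀`. -/
def coord (F : Type*) [NormedAddCommGroup F] [NormedSpace ℝ F] {V : M → Type*}
    [∀ x, AddCommGroup (V x)] [∀ x, Module ℝ (V x)]
    [TopologicalSpace (TotalSpace F V)] [∀ x, TopologicalSpace (V x)] [FiberBundle F V]
    [VectorBundle ℝ F V] (x₀ y : M) : V y →L[ℝ] F :=
  (trivializationAt F V x₀).continuousLinearMapAt ℝ y

/-- The section with constant coordinates `f` in the preferred trivialization at `x₀`. -/
def frame (V : M → Type*) [∀ x, AddCommGroup (V x)] [∀ x, Module ℝ (V x)]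
    [TopologicalSpace (TotalSpace F V)] [∀ x, TopologicalSpace (V x)] [FiberBundle F V]
    [VectorBundle ℝ F V] (x₀ : M) (f : F) (y : M) : V y :=
  (trivializationAt F V x₀).symmL ℝ y f

theorem coord_frame {x₀ y : M} (hy : y ∈ localDomain F V EB x₀) (f : F) :
    coord F x₀ y (frame V x₀ f y) = f :=
  (trivializationAt F V x₀).continuousLinearMapAt_symmL hy.2 f

theorem frame_coord {x₀ y : M} (hy : y ∈ localDomain F V EB x₀) (σ : V y) :
    frame V x₀ (coord F x₀ y σ) y = σ :=
  (trivializationAt F V x₀).symmL_continuousLinearMapAt hy.2 σ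

theorem coord_injective {x₀ y : M} (hy : y ∈ localDomain F V EB x₀) :
    Function.Injective (coord F x₀ y : V y →L[ℝ] F) :=
  Function.LeftInverse.injective (g := fun f => frame V x₀ f y) (frame_coord hy)

theorem coord_eq {x₀ y : M} (hy : y ∈ localDomain F V EB x₀) (σ : V y) :
    (trivializationAt F V x₀ ⟨y, σ⟩).2 = coord F x₀ y σ :=
  ((trivializationAt F V x₀).continuousLinearMapAt_apply_of_mem (R := ℝ) hy.2 σ).symm

theorem extend_eq_frame {x : M} (σ : V x) {y : M} (hy : y ∈ localDomain F V EB x) :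
    extend F σ y = frame V x (coord F x x σ) y := by
  rw [extend, frame, Trivialization.symmL_apply _ hy.2,
    coord_eq (EB := EB) (mem_localDomain_self x)]

/-- The coordinates of an endomorphism in the preferred trivialization at `x₀`. -/
def endCoord (x₀ : M) (A : EndTotal F V) : F →L[ℝ] F :=
  ContinuousLinearMap.inCoordinates F V F V x₀ A.proj x₀ A.proj A.2

theorem endCoord_apply (x₀ : M) (A : EndTotal F V) (f : F) :
    endCoord x₀ A f = coord F x₀ A.proj (A.2 (frame V x₀ f A.proj)) := rfl

theorem endCoord_coord {x₀ : M} {A : EndTotal F V} (hA : A.proj ∈ localDomain F V EB x₀)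
    (σ : V A.proj) : endCoord x₀ A (coord F x₀ A.proj σ) = coord F x₀ A.proj (A.2 σ) := by
  rw [endCoord_apply, frame_coord hA]

variable (F) in
/-- Taking coordinates is a homomorphism from the ring of endomorphisms of the fibre over `y`. -/
def endCoordHom {x₀ y : M} (hy : y ∈ localDomain F V EB x₀) :
    (V y →L[ℝ] V y) →+* (F →L[ℝ] F) where
  toFun A := endCoord x₀ (⟨y, A⟩ : EndTotal F V)
  map_one' := by
    ext f
    exact coord_frame hy f
  map_mul' A B := by
    ext f
    rw [mul_apply_eq_comp, endCoord_apply (A := ⟨y, B⟩), endCoord_coord (A := ⟨y, A⟩) hy]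
    rfl
  map_zero' := by
    ext f
    simp [endCoord_apply]
  map_add' A B := by
    ext f
    simp [endCoord_apply]

theorem endCoordHom_injective {x₀ y : M} (hy : y ∈ localDomain F V EB x₀) :
    Function.Injective (endCoordHom F (V := V) hy) := by
  intro A B h
  ext σ
  apply coord_injective hy
  have h1 := congr($h (coord F x₀ y σ))
  exact (endCoord_coord (A := ⟨y, A⟩) hy σ).symm.trans
    (h1.trans (endCoord_coord (A := ⟨y, B⟩) hy σ))

variable [ContMDiffVectorBundle ∞ F V 𝓘(ℝ, EB)]

theorem contMDiffAt_frame {x₀ y : M} (hy : y ∈ localDomain F V EB x₀) (f : F) :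
    CMDiffAt ∞ (T% (frame V x₀ f)) y := by
  rw [(trivializationAt F V x₀).contMDiffAt_section_iff hy.2]
  refine (contMDiffAt_const (c := f)).congr_of_eventuallyEq ?_
  filter_upwards [(isOpen_localDomain x₀).mem_nhds hy] with z hz
  rw [coord_eq hz, coord_frame hz]

theorem mdifferentiableAt_frame {x₀ y : M} (hy : y ∈ localDomain F V EB x₀) (f : F) :
    MDiffAt (T% (frame V x₀ f)) y :=
  (contMDiffAt_frame hy f).mdifferentiableAt (by simp)

theorem mdifferentiableAt_section_iff_coord {x₀ y : M} (hy : y ∈ localDomain F V EB x₀)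
    {σ : ∀ x : M, V x} :
    MDiffAt (T% σ) y ↔ MDiffAt (fun z => coord F x₀ z (σ z)) y := by
  have : ContMDiffVectorBundle 1 F V 𝓘(ℝ, EB) := .of_le (n := ∞) (by simp)
  rw [(trivializationAt F V x₀).mdifferentiableAt_section_iff _ _ hy.2]
  refine Filter.EventuallyEq.mdifferentiableAt_iff ?_
  filter_upwards [(isOpen_localDomain x₀).mem_nhds hy] with z hz
  rw [coord_eq hz]

theorem IsCovariantDerivativeOn.sum_smul
    {cov : (Π x : M, V x) → (Π x : M, TangentSpace 𝓘(ℝ, EB) x →L[ℝ] V x)}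
    (hcov : IsCovariantDerivativeOn F cov Set.univ) {ι : Type*} (S : Finset ι) {g : ι → M → ℝ}
    {σ : ι → ∀ x : M, V x} {x : M} (hg : ∀ i, MDiffAt (g i) x) (hσ : ∀ i, MDiffAt (T% (σ i)) x) :
    cov (fun y => ∑ i ∈ S, g i y • σ i y) x =
      ∑ i ∈ S, (g i x • cov (σ i) x + (d% (g i) x).smulRight (σ i x)) := by
  classical
  induction S using Finset.induction_on with
  | empty =>
    simp only [Finset.sum_empty]
    exact hcov.zero (x := x)
  | insert i S hi ih =>
    simp only [Finset.sum_insert hi]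
    rw [← ih, ← hcov.leibniz (hσ i) (hg i), ← hcov.add ((hg i).smul_section (hσ i))]
    · rfl
    · exact .sum_section fun j _ => (hg j).smul_section (hσ j)

variable [FiniteDimensional ℝ F]

/-- The connection form at `y` in the preferred chart and trivialization at `x₀`: with `e i` the
sections with constant coordinates given by a basis of `F`, it is `u ↦ (f ↦ ∑ i, f i • ∇_u e i)` in
coordinates. -/
def connFormAt (cov : CovariantDerivative 𝓘(ℝ, EB) F V) (x₀ y : M) : EB →L[ℝ] F →L[ℝ] F :=
  ∑ i, ContinuousLinearMap.smulRightL ℝ F F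
      (LinearMap.toContinuousLinearMap ((Module.finBasis ℝ F).coord i)) ∘L
    ContinuousLinearMap.inCoordinates EB (fun x : M => TangentSpace 𝓘(ℝ, EB) x) F V x₀ y x₀ y
      (cov (frame V x₀ (Module.finBasis ℝ F i)) y)

/-- The connection form in the preferred chart and trivialization at `x₀`, as a function on the
model space. -/
def connForm (cov : CovariantDerivative 𝓘(ℝ, EB) F V) (x₀ : M) (h : EB) : EB →L[ℝ] F →L[ℝ] F :=
  connFormAt cov x₀ ((chartAt EB x₀).symm h)

theorem connForm_apply (cov : CovariantDerivative 𝓘(ℝ, EB) F V) {x₀ y : M}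
    (hy : y ∈ localDomain F V EB x₀) (v : TangentSpace 𝓘(ℝ, EB) y) (f : F) :
    connForm cov x₀ (chartAt EB x₀ y) (chartDeriv x₀ y v) f =
      ∑ i, (Module.finBasis ℝ F).coord i f •
        coord F x₀ y (cov (frame V x₀ (Module.finBasis ℝ F i)) y v) := by
  have h1 : (trivializationAt EB (TangentSpace 𝓘(ℝ, EB)) x₀).symmL ℝ y (chartDeriv x₀ y v) = v := by
    rw [← chartDeriv_eq_trivialization hy.1,
      ← Trivialization.continuousLinearMapAt_apply_of_mem (R := ℝ)]
    · exact Trivialization.symmL_continuousLinearMapAt _ (by simpa using hy.1) v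
    · simpa using hy.1
  rw [connForm, (chartAt EB x₀).left_inv hy.1, connFormAt]
  simp only [sum_apply, ContinuousLinearMap.comp_apply, ContinuousLinearMap.inCoordinates]
  erw [h1]
  rfl

theorem mvfderiv_clm_comp {G : Type*} [NormedAddCommGroup G] [NormedSpace ℝ G] (L : F →L[ℝ] G)
    {s : M → F} {y : M} (hs : MDiffAt s y) (v : TangentSpace 𝓘(ℝ, EB) y) :
    mvfderiv 𝓘(ℝ, EB) (fun z => L (s z)) y v = L (mvfderiv 𝓘(ℝ, EB) s y v) := by
  have h := mfderiv_comp_apply y (L.mdifferentiableAt (x := s y)) hs v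
  refine Eq.trans h ?_
  rw [L.mfderiv_eq]
  rfl

/-- The covariant derivative of a section in the preferred trivialization at `x₀`. -/
theorem coord_cov (cov : CovariantDerivative 𝓘(ℝ, EB) F V) {x₀ y : M}
    (hy : y ∈ localDomain F V EB x₀) {σ : ∀ x : M, V x} (hσ : MDiffAt (T% σ) y)
    (v : TangentSpace 𝓘(ℝ, EB) y) :
    coord F x₀ y (cov σ y v) = mvfderiv 𝓘(ℝ, EB) (fun z => coord F x₀ z (σ z)) y v +
      connForm cov x₀ (chartAt EB x₀ y) (chartDeriv x₀ y v) (coord F x₀ y (σ y)) := by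
  set s : M → F := fun z => coord F x₀ z (σ z)
  let b := Module.finBasis ℝ F
  let L (i) : F →L[ℝ] ℝ := LinearMap.toContinuousLinearMap (b.coord i)
  have hsd : MDiffAt s y := (mdifferentiableAt_section_iff_coord hy).1 hσ
  have hg (i) : MDiffAt (fun z => L i (s z)) y := (L i).mdifferentiableAt.comp y hsd
  have hdg (i) : mvfderiv 𝓘(ℝ, EB) (fun z => L i (s z)) y v = L i (mvfderiv 𝓘(ℝ, EB) s y v) := by
    exact mvfderiv_clm_comp (L i) hsd v
  -- expand the section in the frame, and apply the Leibniz rule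
  have h1 : ∀ᶠ z in 𝓝 y, σ z = ∑ i, L i (s z) • frame V x₀ (b i) z := by
    filter_upwards [(isOpen_localDomain x₀).mem_nhds hy] with z hz
    apply coord_injective hz
    simp only [map_sum, map_smul, coord_frame hz]
    exact (b.sum_repr (s z)).symm
  have h2 := cov.isCovariantDerivativeOn.congr_of_eventuallyEq (s := Set.univ) hσ
    (.sum_section fun j _ => (hg j).smul_section (mdifferentiableAt_frame hy (b j)))
    Filter.univ_mem h1
  rw [h2]
  have h3 := cov.isCovariantDerivativeOn.sum_smul Finset.univ hg
    (fun i => mdifferentiableAt_frame hy (b i))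
  have h4 := congr(coord F x₀ y ($h3 v))
  refine h4.trans ?_
  rw [connForm_apply cov hy]
  simp only [sum_apply, add_apply, ContinuousLinearMap.smulRight_apply, hdg, map_sum, map_add,
    map_smul, Finset.sum_add_distrib, smul_apply, coord_frame hy]
  rw [add_comm]
  congr 1
  exact b.sum_repr _

variable [FiniteDimensional ℝ EB] [T2Space M]

/-- Smoothness of a connection in local form: it maps sections which are smooth near `x` to
sections which are smooth at `x`. -/
theorem contMDiffAt_cov (cov : CovariantDerivative 𝓘(ℝ, EB) F V)
    [hcov : CovariantDerivative.ContMDiffCovariantDerivative cov ∞] {x : M} {s : ∀ x : M, V x}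
    (hs : ∀ᶠ y in 𝓝 x, CMDiffAt ∞ (T% s) y) :
    ContMDiffAt 𝓘(ℝ, EB) (𝓘(ℝ, EB).prod 𝓘(ℝ, EB →L[ℝ] F)) ∞
      (fun y => (⟨y, cov s y⟩ :
        TotalSpace (EB →L[ℝ] F) fun x : M => TangentSpace 𝓘(ℝ, EB) x →L[ℝ] V x)) x := by
  -- multiply the section by a bump function, to obtain one that is smooth everywhere
  obtain ⟨u, hu, huo, hxu⟩ := eventually_nhds_iff.1 hs
  obtain ⟨f, -, hf⟩ :=
    (SmoothBumpFunction.nhds_basis_tsupport (I := 𝓘(ℝ, EB)) x).mem_iff.1 (huo.mem_nhds hxu)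
  have h1 : CMDiff ∞ (T% ((f : M → ℝ) • s)) :=
    ContMDiffOn.smul_section_of_tsupport f.contMDiff.contMDiffOn huo hf
      (fun y hy => (hu y hy).contMDiffWithinAt)
  have h2 := hcov.contMDiff.contMDiff (σ := (f : M → ℝ) • s)
    (by simpa using h1.contMDiffOn (s := Set.univ))
  refine (h2.contMDiffAt (x := x) Filter.univ_mem).congr_of_eventuallyEq ?_
  filter_upwards [f.eventuallyEq_one.eventuallyEq_nhds, huo.mem_nhds hxu] with y hy hyu
  have : cov s y = cov ((f : M → ℝ) • s) y := by
    refine cov.isCovariantDerivativeOn.congr_of_eventuallyEq (s := Set.univ)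
      ((hu y hyu).mdifferentiableAt (by simp)) ((h1 y).mdifferentiableAt (by simp))
      Filter.univ_mem ?_
    filter_upwards [hy] with z hz
    simp [hz]
  rw [this]

theorem contMDiffAt_connFormAt (cov : CovariantDerivative 𝓘(ℝ, EB) F V)
    [CovariantDerivative.ContMDiffCovariantDerivative cov ∞] (x₀ : M) :
    ContMDiffAt 𝓘(ℝ, EB) 𝓘(ℝ, EB →L[ℝ] F →L[ℝ] F) ∞ (connFormAt cov x₀) x₀ := by
  have h (i) : ContMDiffAt 𝓘(ℝ, EB) 𝓘(ℝ, EB →L[ℝ] F) ∞ (fun y =>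
      ContinuousLinearMap.inCoordinates EB (fun x : M => TangentSpace 𝓘(ℝ, EB) x) F V x₀ y x₀ y
      (cov (frame V x₀ (Module.finBasis ℝ F i)) y)) x₀ := by
    have h0 := contMDiffAt_cov cov (x := x₀) (s := frame V x₀ (Module.finBasis ℝ F i)) (by
      filter_upwards [(isOpen_localDomain (F := F) (V := V) x₀).mem_nhds
        (mem_localDomain_self (EB := EB) x₀)] with y hy using contMDiffAt_frame hy _)
    rw [contMDiffAt_hom_bundle] at h0
    exact h0.2
  unfold connFormAt
  refine ContMDiffAt.sum fun i _ => ?_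
  exact ContMDiffAt.clm_comp contMDiffAt_const (h i)

theorem contDiffAt_connForm (cov : CovariantDerivative 𝓘(ℝ, EB) F V)
    [CovariantDerivative.ContMDiffCovariantDerivative cov ∞] (x₀ : M) :
    ContDiffAt ℝ ∞ (connForm cov x₀) (chartAt EB x₀ x₀) := by
  have h1 : ContMDiffAt 𝓘(ℝ, EB) 𝓘(ℝ, EB) ∞ (chartAt EB x₀).symm (chartAt EB x₀ x₀) :=
    (contMDiffOn_chart_symm (x := x₀)).contMDiffAt
      ((chartAt EB x₀).open_target.mem_nhds (mem_chart_target EB x₀))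
  rw [← contMDiffAt_iff_contDiffAt]
  refine ContMDiffAt.comp _ ?_ h1
  rw [(chartAt EB x₀).left_inv (mem_chart_source EB x₀)]
  exact contMDiffAt_connFormAt cov x₀

/-- The vector field near `x₀` which is constant, equal to `w`, in the preferred chart at `x₀`. -/
def constField (x₀ : M) (w : EB) (y : M) : TangentSpace 𝓘(ℝ, EB) y :=
  extend (E := fun x : M => TangentSpace 𝓘(ℝ, EB) x) (x := x₀) EB w y

theorem chartDeriv_constField {x₀ y : M} (hy : y ∈ (chartAt EB x₀).source) (w : EB) :
    chartDeriv x₀ y (constField x₀ w y) = w :=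
  chartDeriv_extend hy _

theorem mdifferentiableAt_constField (x₀ : M) (w : EB) : MDiffAt (T% (constField x₀ w)) x₀ :=
  mdifferentiableAt_extend _ _ _

theorem mlieBracket_constField (x₀ : M) (v w : EB) :
    mlieBracket 𝓘(ℝ, EB) (constField x₀ v) (constField x₀ w) x₀ = 0 := by
  have : CompleteSpace EB := FiniteDimensional.complete ℝ EB
  have h (v : EB) : ∀ᶠ y in 𝓝 x₀,
      chartDeriv x₀ y (constField x₀ v y) = (fun _ => v) (chartAt EB x₀ y) := by
    filter_upwards [(chartAt EB x₀).open_source.mem_nhds (mem_chart_source EB x₀)] with y hy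
      using chartDeriv_constField hy v
  rw [mlieBracket_eq_of_chart (X' := fun _ => v) (Y' := fun _ => w) (h v) (h w)]
  simp only [fderiv_fun_const, Pi.zero_apply, zero_apply, sub_zero]
  rfl

theorem mvfderiv_comp_chart {G : Type*} [NormedAddCommGroup G] [NormedSpace ℝ G] {g : EB → G}
    {x₀ y : M} (hy : y ∈ (chartAt EB x₀).source) (hg : DifferentiableAt ℝ g (chartAt EB x₀ y))
    (v : TangentSpace 𝓘(ℝ, EB) y) :
    mvfderiv 𝓘(ℝ, EB) (fun z => g (chartAt EB x₀ z)) y v =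
      fderiv ℝ g (chartAt EB x₀ y) (chartDeriv x₀ y v) := by
  have : IsManifold 𝓘(ℝ, EB) 1 M := .of_le (n := ∞) (by simp)
  have h := mfderiv_comp_apply (I' := 𝓘(ℝ, EB)) y hg.mdifferentiableAt
    (mdifferentiableAt_extChartAt (I := 𝓘(ℝ, EB)) hy) v
  refine Eq.trans h ?_
  rw [mfderiv_eq_fderiv]
  rfl

/-- The curvature in coordinates is `dΓ + Γ ∧ Γ`. -/
theorem coord_curvature (cov : CovariantDerivative 𝓘(ℝ, EB) F V)
    [CovariantDerivative.ContMDiffCovariantDerivative cov ∞] (x₀ : M)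
    (v w : EB) (e : V x₀) :
    coord F x₀ x₀ (curvature cov x₀ v w e) =
      (fderiv ℝ (connForm cov x₀) (chartAt EB x₀ x₀) v w -
        fderiv ℝ (connForm cov x₀) (chartAt EB x₀ x₀) w v +
        (connForm cov x₀ (chartAt EB x₀ x₀) v * connForm cov x₀ (chartAt EB x₀ x₀) w -
          connForm cov x₀ (chartAt EB x₀ x₀) w * connForm cov x₀ (chartAt EB x₀ x₀) v))
        (coord F x₀ x₀ e) := by
  have hx := mem_localDomain_self (F := F) (V := V) (EB := EB) x₀
  have hnear := (isOpen_localDomain (F := F) (V := V) (EB := EB) x₀).mem_nhds hx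
  have hΓ : DifferentiableAt ℝ (connForm cov x₀) (chartAt EB x₀ x₀) :=
    (contDiffAt_connForm cov x₀).differentiableAt (by simp)
  set f := coord F x₀ x₀ e
  have hs : ∀ᶠ y in 𝓝 x₀, CMDiffAt ∞ (T% (frame V x₀ f)) y := by
    filter_upwards [hnear] with y hy using contMDiffAt_frame hy f
  -- the first covariant derivatives of the section with constant coordinates are given by `Γ`
  have h1 (w : EB) : ∀ᶠ y in 𝓝 x₀, coord F x₀ y (cov (frame V x₀ f) y (constField x₀ w y)) =
      connForm cov x₀ (chartAt EB x₀ y) w f := by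
    filter_upwards [hnear, eventually_mem_nhds_iff.2 hnear] with y hy hy2
    have hc : mvfderiv 𝓘(ℝ, EB) (fun z => coord F x₀ z (frame V x₀ f z)) y = 0 := by
      have : (fun z => coord F x₀ z (frame V x₀ f z)) =ᶠ[𝓝 y] fun _ => f := by
        filter_upwards [hy2] with z hz using coord_frame hz f
      rw [mvfderiv, this.mfderiv_eq, mfderiv_const]
      rfl
    rw [coord_cov cov hy (mdifferentiableAt_frame hy f), coord_frame hy, hc,
      chartDeriv_constField hy.1]
    simp
  -- the second covariant derivatives of the section
  have h2 (v w : EB) : coord F x₀ x₀ (cov (fun y => cov (frame V x₀ f) y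
      (constField x₀ w y)) x₀ (constField x₀ v x₀)) =
      fderiv ℝ (connForm cov x₀) (chartAt EB x₀ x₀) v w f +
      connForm cov x₀ (chartAt EB x₀ x₀) v (connForm cov x₀ (chartAt EB x₀ x₀) w f) := by
    rw [coord_cov cov hx (mdifferentiableAt_cov cov hs (mdifferentiableAt_constField x₀ w)) _,
      (h1 w).self_of_nhds, chartDeriv_constField hx.1]
    have h5 : mvfderiv 𝓘(ℝ, EB) (fun z => coord F x₀ z (cov (frame V x₀ f) z (constField x₀ w z)))
        x₀ = mvfderiv 𝓘(ℝ, EB) (fun z => connForm cov x₀ (chartAt EB x₀ z) w f) x₀ := by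
      have h6 : (fun z => coord F x₀ z (cov (frame V x₀ f) z (constField x₀ w z))) =ᶠ[𝓝 x₀]
        fun z => connForm cov x₀ (chartAt EB x₀ z) w f := h1 w
      rw [mvfderiv, mvfderiv, h6.mfderiv_eq, (h1 w).self_of_nhds]
    have hd : DifferentiableAt ℝ (fun p => connForm cov x₀ p w f) (chartAt EB x₀ x₀) := by
      fun_prop
    rw [h5, mvfderiv_comp_chart hx.1 hd, chartDeriv_constField hx.1,
      fderiv_clm_apply (by fun_prop) (by fun_prop), fderiv_clm_apply (by fun_prop) (by fun_prop)]
    simp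
  -- `curvature` is computed with the extension of `e` that coincides with this section near `x₀`
  have h3 : curvature cov x₀ v w e =
      curvatureField cov (constField x₀ v) (constField x₀ w) (frame V x₀ f) x₀ := by
    refine curvatureField_congr cov (contMDiffAt_extend_eventually (EB := EB) (F := F) e) hs ?_
      (mdifferentiableAt_extend _ _ _) (mdifferentiableAt_extend _ _ _)
    filter_upwards [hnear] with y hy using extend_eq_frame e hy
  rw [h3, curvatureField, mlieBracket_constField, map_zero, sub_zero, map_sub, h2, h2]
  simp only [sub_apply, add_apply, mul_apply_eq_comp]
  abel

end LocalConnection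

/-! ### Parallel curves of endomorphisms in coordinates -/

section Parallel

variable {EB : Type*} [NormedAddCommGroup EB] [NormedSpace ℝ EB]
  {M : Type*} [TopologicalSpace M] [ChartedSpace EB M] [IsManifold 𝓘(ℝ, EB) ∞ M]
  {F : Type*} [NormedAddCommGroup F] [NormedSpace ℝ F]
  {V : M → Type*} [∀ x, AddCommGroup (V x)] [∀ x, Module ℝ (V x)]
  [TopologicalSpace (TotalSpace F V)] [∀ x, TopologicalSpace (V x)]
  [FiberBundle F V] [VectorBundle ℝ F V]
  [∀ x, IsTopologicalAddGroup (V x)] [∀ x, ContinuousSMul ℝ (V x)]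
  [ContMDiffVectorBundle ∞ F V 𝓘(ℝ, EB)]

/-- The velocity of a differentiable curve in the base, read in the preferred chart at `x₀`. -/
theorem hasDerivAt_chart_comp {γ : ℝ → M} {t : ℝ} {x₀ : M} (hγ : MDiffAt γ t)
    (ht : γ t ∈ (chartAt EB x₀).source) :
    HasDerivAt (fun τ => chartAt EB x₀ (γ τ))
      (chartDeriv x₀ (γ t) (mfderiv 𝓘(ℝ, ℝ) 𝓘(ℝ, EB) γ t (1 : ℝ))) t := by
  have : IsManifold 𝓘(ℝ, EB) 1 M := .of_le (n := ∞) (by simp)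
  let L : ℝ →L[ℝ] EB := (chartDeriv x₀ (γ t)).comp (mfderiv 𝓘(ℝ, ℝ) 𝓘(ℝ, EB) γ t)
  have h : HasMFDerivAt 𝓘(ℝ, ℝ) 𝓘(ℝ, EB) (fun τ => chartAt EB x₀ (γ τ)) t L :=
    (mdifferentiableAt_extChartAt (I := 𝓘(ℝ, EB)) ht).hasMFDerivAt.comp t hγ.hasMFDerivAt
  have h' : HasFDerivAt (fun τ => chartAt EB x₀ (γ τ)) L t := hasMFDerivAt_iff_hasFDerivAt.1 h
  have h2 : HasDerivAt (fun τ => chartAt EB x₀ (γ τ)) (L 1) t := h'.hasDerivAt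
  exact h2

theorem hasDerivAt_comp_mvfderiv {G : Type*} [NormedAddCommGroup G] [NormedSpace ℝ G] {g : M → G}
    {γ : ℝ → M} {t : ℝ} (hγ : MDiffAt γ t) (hg : MDiffAt g (γ t)) :
    HasDerivAt (fun τ => g (γ τ))
      (mvfderiv 𝓘(ℝ, EB) g (γ t) (mfderiv 𝓘(ℝ, ℝ) 𝓘(ℝ, EB) γ t (1 : ℝ))) t := by
  let L : ℝ →L[ℝ] G := (mvfderiv 𝓘(ℝ, EB) g (γ t)).comp (mfderiv 𝓘(ℝ, ℝ) 𝓘(ℝ, EB) γ t)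
  have h : HasMFDerivAt 𝓘(ℝ, ℝ) 𝓘(ℝ, G) (fun τ => g (γ τ)) t L :=
    hg.hasMFDerivAt.comp t hγ.hasMFDerivAt
  have h' : HasFDerivAt (fun τ => g (γ τ)) L t := hasMFDerivAt_iff_hasFDerivAt.1 h
  have h2 : HasDerivAt (fun τ => g (γ τ)) (L 1) t := h'.hasDerivAt
  exact h2

/-- The change of coordinates from the preferred trivialization at `x₁` to that at `x₀`. -/
theorem mdifferentiableAt_coord_comp_symmL {x₀ x₁ y : M} (h₀ : y ∈ localDomain F V EB x₀)
    (h₁ : y ∈ localDomain F V EB x₁) :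
    MDifferentiableAt 𝓘(ℝ, EB) 𝓘(ℝ, F →L[ℝ] F)
      (fun z => coord F x₀ z ∘L (trivializationAt F V x₁).symmL ℝ z) y := by
  have h := (contMDiffAt_coordChangeL (n := ∞) (IB := 𝓘(ℝ, EB)) (e := trivializationAt F V x₁)
    (e' := trivializationAt F V x₀) h₁.2 h₀.2).mdifferentiableAt (by simp)
  refine h.congr_of_eventuallyEq ?_
  filter_upwards [(isOpen_localDomain x₀).mem_nhds h₀, (isOpen_localDomain x₁).mem_nhds h₁]
    with z hz₀ hz₁
  ext f
  simp only [ContinuousLinearMap.comp_apply]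
  rw [← coord_eq hz₀, Trivialization.symmL_apply _ hz₁.2]
  simp [Trivialization.coordChangeL_apply _ _ ⟨hz₁.2, hz₀.2⟩]

variable [FiniteDimensional ℝ F]

/-- The covariant derivative of a section along a curve, computed in the preferred trivialization at
an arbitrary point `x₀`. As it is defined with the trivialization at the point `(s t).proj` of the
curve, this is its independence of the trivialization. -/
theorem coord_covDerivAlong (cov : CovariantDerivative 𝓘(ℝ, EB) F V) {s : ℝ → TotalSpace F V}
    {t : ℝ} {x₀ : M} (hs : MDifferentiableAt 𝓘(ℝ, ℝ) (𝓘(ℝ, EB).prod 𝓘(ℝ, F)) s t)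
    (ht : (s t).proj ∈ localDomain F V EB x₀) :
    coord F x₀ (s t).proj (covDerivAlong cov s t) =
      deriv (fun τ => coord F x₀ (s τ).proj (s τ).2) t +
        connForm cov x₀ (chartAt EB x₀ (s t).proj) (deriv (fun τ => chartAt EB x₀ (s τ).proj) t)
          (coord F x₀ (s t).proj (s t).2) := by
  obtain ⟨h1, h2⟩ := (mdifferentiableAt_totalSpace _ _).1 hs
  set γ : ℝ → M := fun τ => (s τ).proj
  set y := (s t).proj
  have hyy := mem_localDomain_self (F := F) (V := V) (EB := EB) y
  have hev : ∀ᶠ τ in 𝓝 t, γ τ ∈ localDomain F V EB y :=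
    h1.continuousAt.eventually_mem ((isOpen_localDomain y).mem_nhds hyy)
  -- the transition function from the trivialization used in the definition to that at `x₀`
  set T : M → F →L[ℝ] F := fun z => coord F x₀ z ∘L (trivializationAt F V y).symmL ℝ z with hT
  have hTd : MDiffAt T y := mdifferentiableAt_coord_comp_symmL ht hyy
  set k : ℝ → F := fun τ => (trivializationAt F V y (s τ)).2
  have hkd : DifferentiableAt ℝ k t := h2.differentiableAt
  have hkt : k t = coord F y y (s t).2 := coord_eq (EB := EB) hyy _
  have hsk : ∀ᶠ τ in 𝓝 t, coord F x₀ (s τ).proj (s τ).2 = T (γ τ) (k τ) := by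
    filter_upwards [hev] with τ hτ
    have h3 : k τ = coord F y (s τ).proj (s τ).2 := coord_eq hτ _
    rw [h3]
    exact congrArg _ (frame_coord hτ (s τ).2).symm
  have hTγ := hasDerivAt_comp_mvfderiv (t := t) h1 hTd
  have hprod := hTγ.clm_apply hkd.hasDerivAt
  have hd := (hprod.congr_of_eventuallyEq hsk).deriv
  rw [hd, (hasDerivAt_chart_comp h1 ht.1).deriv, covDerivAlong, map_add,
    coord_cov cov ht (mdifferentiableAt_extend _ _ _), extend_apply_self]
  have h4 : mvfderiv 𝓘(ℝ, EB) (fun z => coord F x₀ z (extend F (s t).2 z)) y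
      (mfderiv 𝓘(ℝ, ℝ) 𝓘(ℝ, EB) γ t (1 : ℝ)) = mvfderiv 𝓘(ℝ, EB) T y
      (mfderiv 𝓘(ℝ, ℝ) 𝓘(ℝ, EB) γ t (1 : ℝ)) (k t) := by
    have h6 : (fun z => coord F x₀ z (extend F (s t).2 z)) =ᶠ[𝓝 y] fun z => T z (k t) := by
      filter_upwards [(isOpen_localDomain y).mem_nhds hyy] with z hz
      rw [extend_eq_frame _ hz, hkt]
      rfl
    have h7 := mvfderiv_clm_comp (ContinuousLinearMap.apply ℝ F (k t)) hTd
      (mfderiv 𝓘(ℝ, ℝ) 𝓘(ℝ, EB) γ t (1 : ℝ))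
    refine Eq.trans ?_ h7
    rw [mvfderiv, mvfderiv, h6.mfderiv_eq]
    rfl
  have h5 : coord F x₀ y ((trivializationAt F V y).symm y (deriv k t)) = T y (deriv k t) := by
    rw [hT, ContinuousLinearMap.comp_apply, Trivialization.symmL_apply _ hyy.2]
  rw [h5, ← h4]
  abel

/-- A differentiable curve in the total space of `End V` is parallel if and only if it satisfies the
equation `a' + [Γ x', a] = 0` of parallel transport in coordinates. -/
theorem isParallelEndAt_iff (cov : CovariantDerivative 𝓘(ℝ, EB) F V) {c : ℝ → EndTotal F V}
    {t : ℝ} {x₀ : M} (hc : MDifferentiableAt 𝓘(ℝ, ℝ) (𝓘(ℝ, EB).prod 𝓘(ℝ, F →L[ℝ] F)) c t)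
    (had : DifferentiableAt ℝ (fun τ => endCoord x₀ (c τ)) t)
    (ht : (c t).proj ∈ localDomain F V EB x₀) :
    IsParallelEndAt cov c t ↔
      deriv (fun τ => endCoord x₀ (c τ)) t +
        (connForm cov x₀ (chartAt EB x₀ (c t).proj) (deriv (fun τ => chartAt EB x₀ (c τ).proj) t) *
          endCoord x₀ (c t) - endCoord x₀ (c t) *
          connForm cov x₀ (chartAt EB x₀ (c t).proj)
            (deriv (fun τ => chartAt EB x₀ (c τ).proj) t)) = 0 := by
  have hproj : MDiffAt (fun τ => (c τ).proj) t := ((mdifferentiableAt_totalSpace _ _).1 hc).1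
  have hev : ∀ᶠ τ in 𝓝 t, (c τ).proj ∈ localDomain F V EB x₀ :=
    hproj.continuousAt.eventually_mem ((isOpen_localDomain x₀).mem_nhds ht)
  set Γ := connForm cov x₀ (chartAt EB x₀ (c t).proj) (deriv (fun τ => chartAt EB x₀ (c τ).proj) t)
  set a := fun τ => endCoord x₀ (c τ)
  -- both sides of the Leibniz rule for a section `s` along the curve, in coordinates
  have key (s : ∀ τ : ℝ, V (c τ).proj) (hs : MDifferentiableAt 𝓘(ℝ, ℝ) (𝓘(ℝ, EB).prod 𝓘(ℝ, F))
        (fun τ => (⟨(c τ).proj, s τ⟩ : TotalSpace F V)) t)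
      (hk : DifferentiableAt ℝ (fun τ => coord F x₀ (c τ).proj (s τ)) t) :
      coord F x₀ (c t).proj
        (covDerivAlong cov (fun τ => (⟨(c τ).proj, (c τ).2 (s τ)⟩ : TotalSpace F V)) t) -
      coord F x₀ (c t).proj ((c t).2
        (covDerivAlong cov (fun τ => (⟨(c τ).proj, s τ⟩ : TotalSpace F V)) t)) =
      (deriv a t + (Γ * a t - a t * Γ)) (coord F x₀ (c t).proj (s t)) := by
    have h1 := coord_covDerivAlong cov hs ht
    have h2 := coord_covDerivAlong cov (MDifferentiableAt.clm_bundle_apply hc hs) ht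
    have h3 : (fun τ => coord F x₀ (c τ).proj ((c τ).2 (s τ))) =ᶠ[𝓝 t]
        fun τ => a τ (coord F x₀ (c τ).proj (s τ)) := by
      filter_upwards [hev] with τ hτ using (endCoord_coord hτ (s τ)).symm
    have h4 := h3.deriv_eq
    rw [deriv_clm_apply had hk] at h4
    refine (congrArg₂ (· - ·) h2 ((endCoord_coord ht _).symm.trans
      (congrArg (endCoord x₀ (c t)) h1))).trans ?_
    have h5 := endCoord_coord ht (s t)
    change deriv (fun τ => coord F x₀ (c τ).proj ((c τ).2 (s τ))) t +
      Γ (coord F x₀ (c t).proj ((c t).2 (s t))) -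
      a t (deriv (fun τ => coord F x₀ (c τ).proj (s τ)) t + Γ (coord F x₀ (c t).proj (s t))) = _
    rw [h4, ← h5]
    simp only [add_apply, sub_apply, mul_apply_eq_comp, map_add]
    abel
  -- sections with constant coordinates along the curve detect the coefficient of `s t` in `key`
  refine ⟨fun hpar => ContinuousLinearMap.ext fun f => ?_, fun h => ⟨hc, fun s hs => ?_⟩⟩
  · have hs : MDifferentiableAt 𝓘(ℝ, ℝ) (𝓘(ℝ, EB).prod 𝓘(ℝ, F))
        (fun τ => (⟨(c τ).proj, frame V x₀ f (c τ).proj⟩ : TotalSpace F V)) t :=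
      (mdifferentiableAt_frame ht f).comp t hproj
    have hk : DifferentiableAt ℝ (fun τ => coord F x₀ (c τ).proj (frame V x₀ f (c τ).proj)) t := by
      refine (differentiableAt_const f).congr_of_eventuallyEq ?_
      filter_upwards [hev] with τ hτ using coord_frame hτ f
    have h1 := key _ hs hk
    rw [hpar.2 _ hs, coord_frame ht] at h1
    exact h1.symm.trans (sub_self _)
  · have hk : DifferentiableAt ℝ (fun τ => coord F x₀ (c τ).proj (s τ)) t := by
      have h1 := ((Trivialization.mdifferentiableAt_totalSpace_iff 𝓘(ℝ, EB)
        (trivializationAt F V x₀) _ ((trivializationAt F V x₀).mem_source.2 ht.2)).1 hs).2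
      refine h1.differentiableAt.congr_of_eventuallyEq ?_
      filter_upwards [hev] with τ hτ using (coord_eq hτ _).symm
    apply coord_injective ht
    rw [← sub_eq_zero]
    refine (key s hs hk).trans ?_
    rw [h]
    simp

end Parallel

/-! ### Horizontal space and vertical projection in coordinates -/

section Horizontal

variable {EB : Type*} [NormedAddCommGroup EB] [NormedSpace ℝ EB]
  {M : Type*} [TopologicalSpace M] [ChartedSpace EB M] [IsManifold 𝓘(ℝ, EB) ∞ M]
  {F : Type*} [NormedAddCommGroup F] [NormedSpace ℝ F] [FiniteDimensional ℝ F]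
  {V : M → Type*} [∀ x, AddCommGroup (V x)] [∀ x, Module ℝ (V x)]
  [TopologicalSpace (TotalSpace F V)] [∀ x, TopologicalSpace (V x)]
  [FiberBundle F V] [VectorBundle ℝ F V]
  [∀ x, IsTopologicalAddGroup (V x)] [∀ x, ContinuousSMul ℝ (V x)]
  [ContMDiffVectorBundle ∞ F V 𝓘(ℝ, EB)]

variable (EB) in
/-- The coordinates on the total space of `End V` given by the preferred chart and trivialization at
`x₀`. -/
def endMap (x₀ : M) (A : EndTotal F V) : EB × (F →L[ℝ] F) :=
  (chartAt EB x₀ A.proj, endCoord x₀ A)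

/-- The differential of the coordinates on the total space of `End V`. -/
def endDeriv (x₀ : M) (A : EndTotal F V) :
    TangentSpace (𝓘(ℝ, EB).prod 𝓘(ℝ, F →L[ℝ] F)) A →L[ℝ] EB × (F →L[ℝ] F) :=
  mfderiv (𝓘(ℝ, EB).prod 𝓘(ℝ, F →L[ℝ] F)) 𝓘(ℝ, EB × (F →L[ℝ] F)) (endMap EB x₀) A

theorem extChartAt_eq_endMap (A₀ : EndTotal F V) :
    (extChartAt (𝓘(ℝ, EB).prod 𝓘(ℝ, F →L[ℝ] F)) A₀ : EndTotal F V → EB × (F →L[ℝ] F)) =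
      endMap EB A₀.proj := by
  funext A
  exact hom_chart (HB := EB) A₀ A

theorem mem_extChartAt_source_iff {A₀ A : EndTotal F V} :
    A ∈ (extChartAt (𝓘(ℝ, EB).prod 𝓘(ℝ, F →L[ℝ] F)) A₀).source ↔
      A.proj ∈ localDomain F V EB A₀.proj := by
  rw [extChartAt_source, FiberBundle.chartedSpace_chartAt]
  simp only [mfld_simps, localDomain]
  tauto

theorem mdifferentiableAt_endMap {x₀ : M} {A : EndTotal F V} (hA : A.proj ∈ localDomain F V EB x₀) :
    MDifferentiableAt (𝓘(ℝ, EB).prod 𝓘(ℝ, F →L[ℝ] F)) 𝓘(ℝ, EB × (F →L[ℝ] F)) (endMap EB x₀) A := by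
  have : IsManifold (𝓘(ℝ, EB).prod 𝓘(ℝ, F →L[ℝ] F)) 1 (EndTotal F V) := .of_le (n := ∞) (by simp)
  rw [← extChartAt_eq_endMap (⟨x₀, 0⟩ : EndTotal F V)]
  apply mdifferentiableAt_extChartAt
  rw [← extChartAt_source (𝓘(ℝ, EB).prod 𝓘(ℝ, F →L[ℝ] F))]
  exact mem_extChartAt_source_iff.2 hA

theorem endDeriv_bijective {x₀ : M} {A : EndTotal F V} (hA : A.proj ∈ localDomain F V EB x₀) :
    Function.Bijective (endDeriv (EB := EB) x₀ A) := by
  have : IsManifold (𝓘(ℝ, EB).prod 𝓘(ℝ, F →L[ℝ] F)) 1 (EndTotal F V) := .of_le (n := ∞) (by simp)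
  have h := (isInvertible_mfderiv_extChartAt (I := 𝓘(ℝ, EB).prod 𝓘(ℝ, F →L[ℝ] F))
    (mem_extChartAt_source_iff (A₀ := (⟨x₀, 0⟩ : EndTotal F V)).2 hA)).bijective
  rw [extChartAt_eq_endMap] at h
  exact h

theorem hasDerivAt_endMap_comp {c : ℝ → EndTotal F V} {t : ℝ} {x₀ : M}
    (hc : MDifferentiableAt 𝓘(ℝ, ℝ) (𝓘(ℝ, EB).prod 𝓘(ℝ, F →L[ℝ] F)) c t)
    (ht : (c t).proj ∈ localDomain F V EB x₀) :
    HasDerivAt (fun τ => endMap EB x₀ (c τ)) (endDeriv x₀ (c t)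
      (mfderiv 𝓘(ℝ, ℝ) (𝓘(ℝ, EB).prod 𝓘(ℝ, F →L[ℝ] F)) c t (1 : ℝ))) t := by
  let L : ℝ →L[ℝ] EB × (F →L[ℝ] F) := (endDeriv x₀ (c t)).comp
    (mfderiv 𝓘(ℝ, ℝ) (𝓘(ℝ, EB).prod 𝓘(ℝ, F →L[ℝ] F)) c t)
  have h : HasMFDerivAt 𝓘(ℝ, ℝ) 𝓘(ℝ, EB × (F →L[ℝ] F)) (fun τ => endMap EB x₀ (c τ)) t L :=
    (mdifferentiableAt_endMap ht).hasMFDerivAt.comp t hc.hasMFDerivAt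
  have h' : HasFDerivAt (fun τ => endMap EB x₀ (c τ)) L t := hasMFDerivAt_iff_hasFDerivAt.1 h
  have h2 : HasDerivAt (fun τ => endMap EB x₀ (c τ)) (L 1) t := h'.hasDerivAt
  exact h2

theorem isParallelEndAt_iff_modelVert (cov : CovariantDerivative 𝓘(ℝ, EB) F V)
    {c : ℝ → EndTotal F V} {t : ℝ} {x₀ : M}
    (hc : MDifferentiableAt 𝓘(ℝ, ℝ) (𝓘(ℝ, EB).prod 𝓘(ℝ, F →L[ℝ] F)) c t)
    (ht : (c t).proj ∈ localDomain F V EB x₀) :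
    IsParallelEndAt cov c t ↔ modelVert (connForm cov x₀) (endMap EB x₀ (c t))
      (endDeriv x₀ (c t) (mfderiv 𝓘(ℝ, ℝ) (𝓘(ℝ, EB).prod 𝓘(ℝ, F →L[ℝ] F)) c t (1 : ℝ))) = 0 := by
  have h := hasDerivAt_endMap_comp hc ht
  have h1 : HasDerivAt (fun τ => chartAt EB x₀ (c τ).proj) _ t :=
    (ContinuousLinearMap.fst ℝ EB (F →L[ℝ] F)).hasFDerivAt.comp_hasDerivAt t h
  have h2 : HasDerivAt (fun τ => endCoord x₀ (c τ)) _ t :=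
    (ContinuousLinearMap.snd ℝ EB (F →L[ℝ] F)).hasFDerivAt.comp_hasDerivAt t h
  rw [isParallelEndAt_iff cov hc h2.differentiableAt ht, h1.deriv, h2.deriv, modelVert_apply]
  rfl

/-- The horizontal space in coordinates. Solving the equation of parallel transport shows that it
contains all vectors with zero vertical part. -/
theorem mem_horizontal_iff (cov : CovariantDerivative 𝓘(ℝ, EB) F V) [CompleteSpace EB] {x₀ : M}
    {A : EndTotal F V} (hA : A.proj ∈ localDomain F V EB x₀)
    (hΓ : ContDiffAt ℝ 1 (connForm cov x₀) (chartAt EB x₀ A.proj))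
    (X : TangentSpace (𝓘(ℝ, EB).prod 𝓘(ℝ, F →L[ℝ] F)) A) :
    X ∈ horizontal cov A ↔
      modelVert (connForm cov x₀) (endMap EB x₀ A) (endDeriv x₀ A X) = 0 := by
  constructor
  · rintro ⟨c, hpar, hcX⟩
    -- the velocity of `c` is only equal to `X` as a point of the tangent bundle, since `c 0 = A` is
    -- a propositional equality
    have key : ∀ Z : TangentBundle (𝓘(ℝ, EB).prod 𝓘(ℝ, F →L[ℝ] F)) (EndTotal F V),
        Z = ⟨c 0, mfderiv 𝓘(ℝ, ℝ) (𝓘(ℝ, EB).prod 𝓘(ℝ, F →L[ℝ] F)) c 0 (1 : ℝ)⟩ →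
        Z.proj.proj ∈ localDomain F V EB x₀ →
        modelVert (connForm cov x₀) (endMap EB x₀ Z.proj) (endDeriv x₀ Z.proj Z.2) = 0 := by
      rintro _ rfl h0
      exact (isParallelEndAt_iff_modelVert cov hpar.self_of_nhds.1 h0).1 hpar.self_of_nhds
    exact key ⟨A, X⟩ hcX.symm hA
  · intro hX
    let ψ := extChartAt (𝓘(ℝ, EB).prod 𝓘(ℝ, F →L[ℝ] F)) (⟨x₀, 0⟩ : EndTotal F V)
    have hψ : ∀ B, ψ B = endMap EB x₀ B := congrFun (extChartAt_eq_endMap (⟨x₀, 0⟩ : EndTotal F V))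
    have hAψ : A ∈ ψ.source := mem_extChartAt_source_iff.2 hA
    set Γ := connForm cov x₀
    set u := (endDeriv x₀ A X).1
    -- the base curve has the constant velocity `u` in the chart, and `a' = -[Γ u, a]`
    let W : EB × (F →L[ℝ] F) → EB × (F →L[ℝ] F) :=
      fun p => (u, -(Γ p.1 u * p.2 - p.2 * Γ p.1 u))
    have hW : ContDiffAt ℝ 1 W (endMap EB x₀ A) := by
      have h1 : ContDiffAt ℝ 1 (fun p : EB × (F →L[ℝ] F) => Γ p.1) (endMap EB x₀ A) :=
        ContDiffAt.comp (endMap EB x₀ A) (g := Γ) hΓ contDiffAt_fst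
      have h2 : ContDiffAt ℝ 1 (fun p : EB × (F →L[ℝ] F) => Γ p.1 u) (endMap EB x₀ A) :=
        h1.clm_apply contDiffAt_const
      exact contDiffAt_const.prodMk ((h2.mul contDiffAt_snd).sub (contDiffAt_snd.mul h2)).neg
    obtain ⟨α, hα0, ε, hε, hα⟩ :=
      hW.exists_forall_mem_closedBall_exists_eq_forall_mem_Ioo_hasDerivAt₀ 0
    have hopen : IsOpen ψ.target := isOpen_extChartAt_target _
    have hα0' : α 0 ∈ ψ.target := by
      rw [hα0, ← hψ]
      exact ψ.map_source hAψ
    have hcont : ContinuousAt α 0 := (hα 0 (by simpa using hε)).continuousAt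
    have hev : ∀ᶠ t in 𝓝 0, α t ∈ ψ.target ∧ HasDerivAt α (W (α t)) t :=
      (hcont.eventually_mem (hopen.mem_nhds hα0')).and
        (Filter.eventually_of_mem (Ioo_mem_nhds (by linarith) (by linarith)) hα)
    let c : ℝ → EndTotal F V := fun t => ψ.symm (α t)
    have hc : ∀ᶠ t in 𝓝 0, endMap EB x₀ (c t) = α t ∧ (c t).proj ∈ localDomain F V EB x₀ ∧
        MDifferentiableAt 𝓘(ℝ, ℝ) (𝓘(ℝ, EB).prod 𝓘(ℝ, F →L[ℝ] F)) c t ∧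
        endDeriv x₀ (c t) (mfderiv 𝓘(ℝ, ℝ) (𝓘(ℝ, EB).prod 𝓘(ℝ, F →L[ℝ] F)) c t (1 : ℝ)) =
          W (α t) := by
      filter_upwards [hev.eventually_nhds] with t ht
      obtain ⟨ht1, ht2⟩ := ht.self_of_nhds
      have h1 : (c t).proj ∈ localDomain F V EB x₀ :=
        mem_extChartAt_source_iff.1 (ψ.map_target ht1)
      have h2 : ∀ᶠ τ in 𝓝 t, endMap EB x₀ (c τ) = α τ := by
        filter_upwards [ht] with τ hτ
        rw [← hψ]
        exact ψ.right_inv hτ.1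
      have h3 : MDifferentiableAt 𝓘(ℝ, ℝ) (𝓘(ℝ, EB).prod 𝓘(ℝ, F →L[ℝ] F)) c t := by
        have h4 : MDifferentiableAt 𝓘(ℝ, EB × (F →L[ℝ] F)) (𝓘(ℝ, EB).prod 𝓘(ℝ, F →L[ℝ] F))
            ψ.symm (α t) :=
          ((contMDiffOn_extChartAt_symm (n := ∞) _).contMDiffAt
            (hopen.mem_nhds ht1)).mdifferentiableAt (by simp)
        exact h4.comp t ht2.differentiableAt.mdifferentiableAt
      exact ⟨h2.self_of_nhds, h1, h3,
        ((hasDerivAt_endMap_comp h3 h1).congr_of_eventuallyEq (h2.mono fun _ h => h.symm)).unique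
          ht2⟩
    have hc0 : c 0 = A := by
      change ψ.symm (α 0) = A
      rw [hα0, ← hψ, ψ.left_inv hAψ]
    refine ⟨c, ?_, ?_⟩
    · filter_upwards [hc] with t ⟨h1, h2, h3, h4⟩
      rw [isParallelEndAt_iff_modelVert cov h3 h2, h4, h1, modelVert_apply]
      exact neg_add_cancel _
    · have key : ∀ (B : EndTotal F V) (Y : TangentSpace (𝓘(ℝ, EB).prod 𝓘(ℝ, F →L[ℝ] F)) B),
          B = A → endDeriv x₀ B Y = endDeriv x₀ A X →
          (⟨B, Y⟩ : TangentBundle (𝓘(ℝ, EB).prod 𝓘(ℝ, F →L[ℝ] F)) (EndTotal F V)) = ⟨A, X⟩ := by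
        rintro B Y rfl h
        rw [(endDeriv_bijective hA).1 h]
      refine key _ _ hc0 (hc.self_of_nhds.2.2.2.trans ?_)
      rw [hα0]
      rw [modelVert_apply] at hX
      exact Prod.ext rfl (eq_neg_of_add_eq_zero_left hX).symm

theorem endCoord_add_smul {x₀ x : M} (A B : V x →L[ℝ] V x)
    (t : ℝ) : endCoord x₀ (⟨x, A + t • B⟩ : EndTotal F V) =
      endCoord x₀ (⟨x, A⟩ : EndTotal F V) + t • endCoord x₀ (⟨x, B⟩ : EndTotal F V) := by
  ext f
  simp [endCoord_apply]

theorem endDeriv_verticalLift {x₀ : M} {A : EndTotal F V} (hA : A.proj ∈ localDomain F V EB x₀)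
    (B : V A.proj →L[ℝ] V A.proj) : endDeriv x₀ A (verticalLift (EB := EB) A B) =
      (0, endCoord x₀ (⟨A.proj, B⟩ : EndTotal F V)) := by
  let c : ℝ → EndTotal F V := fun t => ⟨A.proj, A.2 + t • B⟩
  have hd (x₁ : M) : HasDerivAt (fun t => endCoord x₁ (c t))
      (endCoord x₁ (⟨A.proj, B⟩ : EndTotal F V)) 0 := by
    have h1 : HasDerivAt (fun t : ℝ => endCoord x₁ (⟨A.proj, A.2⟩ : EndTotal F V) +
        t • endCoord x₁ (⟨A.proj, B⟩ : EndTotal F V))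
        ((1 : ℝ) • endCoord x₁ (⟨A.proj, B⟩ : EndTotal F V)) 0 :=
      ((hasDerivAt_id (0 : ℝ)).smul_const _).const_add _
    rw [one_smul] at h1
    exact h1.congr_of_eventuallyEq (.of_forall fun t => endCoord_add_smul A.2 B t)
  have hc : MDifferentiableAt 𝓘(ℝ, ℝ) (𝓘(ℝ, EB).prod 𝓘(ℝ, F →L[ℝ] F)) c 0 := by
    rw [mdifferentiableAt_totalSpace]
    refine ⟨mdifferentiableAt_const, ?_⟩
    have h1 := (hd A.proj).differentiableAt.mdifferentiableAt
    exact h1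
  -- `c 0` and `A` are not definitionally equal, but the tangent spaces at them are
  have hc0 : c 0 = A := by
    change (⟨A.proj, A.2 + (0 : ℝ) • B⟩ : EndTotal F V) = A
    rw [zero_smul, add_zero]
  have h1 := hasDerivAt_endMap_comp (x₀ := x₀) hc hA
  have h2 : HasDerivAt (fun t => endMap EB x₀ (c t))
      (0, endCoord x₀ (⟨A.proj, B⟩ : EndTotal F V)) 0 :=
    (hasDerivAt_const (0 : ℝ) (chartAt EB x₀ A.proj)).prodMk (hd x₀)
  have key : ∀ (A' : EndTotal F V) (Z : EB × (F →L[ℝ] F)), A' = A →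
      endDeriv (EB := EB) x₀ A' Z = endDeriv (EB := EB) x₀ A Z := by
    rintro _ _ rfl
    rfl
  exact (key _ _ hc0).symm.trans (h1.unique h2)

/-- The vertical projection in coordinates. -/
theorem endCoord_endVerticalProj (cov : CovariantDerivative 𝓘(ℝ, EB) F V) [CompleteSpace EB]
    {x₀ : M} {A : EndTotal F V} (hA : A.proj ∈ localDomain F V EB x₀)
    (hΓ : ContDiffAt ℝ 1 (connForm cov x₀) (chartAt EB x₀ A.proj))
    (X : TangentSpace (𝓘(ℝ, EB).prod 𝓘(ℝ, F →L[ℝ] F)) A) :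
    endCoord x₀ (⟨A.proj, endVerticalProj cov A X⟩ : EndTotal F V) =
      modelVert (connForm cov x₀) (endMap EB x₀ A) (endDeriv x₀ A X) := by
  have h (B : V A.proj →L[ℝ] V A.proj) : X - verticalLift A B ∈ horizontal cov A ↔
      endCoord x₀ (⟨A.proj, B⟩ : EndTotal F V) =
        modelVert (connForm cov x₀) (endMap EB x₀ A) (endDeriv x₀ A X) := by
    rw [mem_horizontal_iff cov hA hΓ, ContinuousLinearMap.map_sub, map_sub,
      endDeriv_verticalLift hA, sub_eq_zero, eq_comm, modelVert_apply _ _ (0, _)]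
    simp
  -- the required endomorphism is the one with the given coordinates
  refine (h _).1 (Classical.epsilon_spec (p := fun B => X - verticalLift A B ∈ horizontal cov A)
    ⟨(trivializationAt F V x₀).symmL ℝ A.proj ∘L
      modelVert (connForm cov x₀) (endMap EB x₀ A) (endDeriv x₀ A X) ∘L coord F x₀ A.proj,
      (h _).2 ?_⟩)
  ext f
  change coord F x₀ A.proj (frame V x₀ (modelVert (connForm cov x₀) (endMap EB x₀ A)
    (endDeriv x₀ A X) (coord F x₀ A.proj (frame V x₀ f A.proj))) A.proj) = _
  rw [coord_frame hA, coord_frame hA]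

end Horizontal

/-! ### The differential of the Cayley parametrization -/

section CayleyDerivative

variable {F : Type*} [NormedAddCommGroup F] [NormedSpace ℝ F] [FiniteDimensional ℝ F]
  (j : F →L[ℝ] F) (hj : j * j = -1)

theorem eventually_isUnit_one_add {k : TwistorModel F}
    (hk : IsUnit (1 + ((antiCommEquiv j hj).symm k : F →L[ℝ] F))) :
    ∀ᶠ l in 𝓝 k, IsUnit (1 + ((antiCommEquiv j hj).symm l : F →L[ℝ] F)) := by
  have : CompleteSpace F := FiniteDimensional.complete ℝ F
  have hc : Continuous fun l : TwistorModel F =>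
      1 + ((antiCommEquiv j hj).symm l : F →L[ℝ] F) := by fun_prop
  exact hc.continuousAt.eventually_mem (Units.isOpen.mem_nhds hk)

/-- The derivative of `cayleyInv k ^ 2 = -1`. -/
theorem fderiv_cayleyInv_anticomm {k : TwistorModel F}
    (hk : IsUnit (1 + ((antiCommEquiv j hj).symm k : F →L[ℝ] F))) (a : TwistorModel F) :
    fderiv ℝ (cayleyInv j hj) k a * cayleyInv j hj k +
      cayleyInv j hj k * fderiv ℝ (cayleyInv j hj) k a = 0 := by
  have hd := ((contDiffAt_cayleyInv j hj hk).differentiableAt (by simp)).hasFDerivAt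
  have h1 := hd.mul' hd
  have h2 : (fun l => cayleyInv j hj l * cayleyInv j hj l) =ᶠ[𝓝 k] fun _ => -1 := by
    filter_upwards [eventually_isUnit_one_add j hj hk] with l hl using cayleyInv_sq j hj l hl
  have h3 := h1.unique ((hasFDerivAt_const (-1 : F →L[ℝ] F) k).congr_of_eventuallyEq h2)
  have h4 := congr($h3 a)
  exact (add_comm _ _).trans h4

theorem fderiv_cayley_fderiv_cayleyInv {k : TwistorModel F}
    (hk : IsUnit (1 + ((antiCommEquiv j hj).symm k : F →L[ℝ] F))) (a : TwistorModel F) :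
    fderiv ℝ (cayley j hj) (cayleyInv j hj k) (fderiv ℝ (cayleyInv j hj) k a) = a := by
  have hd := ((contDiffAt_cayleyInv j hj hk).differentiableAt (by simp)).hasFDerivAt
  have hd' := ((contDiffAt_cayley j hj (isUnit_cayleyInv_add j hj k hk)).differentiableAt
    (by simp)).hasFDerivAt
  have h2 : (fun l => cayley j hj (cayleyInv j hj l)) =ᶠ[𝓝 k] fun l => l := by
    filter_upwards [eventually_isUnit_one_add j hj hk] with l hl using cayley_cayleyInv j hj l hl
  have h3 := (hd'.comp k hd).unique ((hasFDerivAt_id k).congr_of_eventuallyEq h2)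
  exact congr($h3 a)

/-- The tangent space of the space of complex structures is the range of the differential of the
Cayley parametrization, because the dimensions agree. -/
theorem exists_fderiv_cayleyInv_eq {k : TwistorModel F}
    (hk : IsUnit (1 + ((antiCommEquiv j hj).symm k : F →L[ℝ] F))) {b : F →L[ℝ] F}
    (hb : b * cayleyInv j hj k + cayleyInv j hj k * b = 0) :
    ∃ a, fderiv ℝ (cayleyInv j hj) k a = b := by
  let D : TwistorModel F →ₗ[ℝ] antiComm (cayleyInv j hj k) :=
    LinearMap.codRestrict _ (fderiv ℝ (cayleyInv j hj) k : TwistorModel F →ₗ[ℝ] (F →L[ℝ] F))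
      (fderiv_cayleyInv_anticomm j hj hk)
  have hinj : Function.Injective D := by
    refine Function.LeftInverse.injective
      (g := fun b => fderiv ℝ (cayley j hj) (cayleyInv j hj k) b.1) fun a => ?_
    exact fderiv_cayley_fderiv_cayleyInv j hj hk a
  have hsurj := (LinearMap.injective_iff_surjective_of_finrank_eq_finrank
    (finrank_antiComm _ (cayleyInv_sq j hj k hk)).symm).1 hinj
  obtain ⟨a, ha⟩ := hsurj ⟨b, hb⟩
  exact ⟨a, congr(($ha).1)⟩

end CayleyDerivative

/-! ### The twistor complex structure in the Cayley parametrization -/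

section TwistorModelMap

variable {E : Type*} [NormedAddCommGroup E] [NormedSpace ℝ E]
  {F : Type*} [NormedAddCommGroup F] [NormedSpace ℝ F] [FiniteDimensional ℝ F]
  (j : F →L[ℝ] F) (hj : j * j = -1)

variable (E) in
/-- The parametrization of `E × {a | a ^ 2 = -1}` by the model space of the twistor space. -/
def twistorParam (p : E × TwistorModel F) : E × (F →L[ℝ] F) :=
  (p.1, cayleyInv j hj p.2)

variable (E) in
/-- The open set on which `twistorParam` is an immersion onto complex structures: there `1 + a` is
invertible, and `Ring.inverse` in `cayleyInv` is not a junk value. -/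
def twistorParamDomain : Set (E × TwistorModel F) :=
  {p | IsUnit (1 + ((antiCommEquiv j hj).symm p.2 : F →L[ℝ] F))}

variable {j hj} {p : E × TwistorModel F}

theorem twistorParamDomain_mem_nhds (hp : p ∈ twistorParamDomain E j hj) :
    twistorParamDomain E j hj ∈ 𝓝 p :=
  continuousAt_snd.eventually (eventually_isUnit_one_add j hj hp)

theorem contDiffAt_twistorParam (hp : p ∈ twistorParamDomain E j hj) :
    ContDiffAt ℝ ∞ (twistorParam E j hj) p :=
  contDiffAt_fst.prodMk ((contDiffAt_cayleyInv j hj hp).comp p contDiffAt_snd)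

theorem fderiv_twistorParam (hp : p ∈ twistorParamDomain E j hj) (X : E × TwistorModel F) :
    fderiv ℝ (twistorParam E j hj) p X = (X.1, fderiv ℝ (cayleyInv j hj) p.2 X.2) := by
  have hd := ((contDiffAt_cayleyInv j hj hp).differentiableAt (by simp)).hasFDerivAt
  have h : HasFDerivAt (twistorParam E j hj) _ p :=
    (hasFDerivAt_fst (𝕜 := ℝ) (p := p)).prodMk (hd.comp p hasFDerivAt_snd)
  rw [h.fderiv]
  rfl

/-- The left inverse of the differential of the parametrization given by the Cayley chart. -/
def twistorParamLeft (E : Type*) [NormedAddCommGroup E] [NormedSpace ℝ E] (j : F →L[ℝ] F)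
    (hj : j * j = -1) (p : E × TwistorModel F) : E × (F →L[ℝ] F) →L[ℝ] E × TwistorModel F :=
  (ContinuousLinearMap.fst ℝ E (F →L[ℝ] F)).prod
    (fderiv ℝ (cayley j hj) (cayleyInv j hj p.2) ∘L ContinuousLinearMap.snd ℝ E (F →L[ℝ] F))

theorem twistorParamLeft_fderiv (hp : p ∈ twistorParamDomain E j hj) (X : E × TwistorModel F) :
    twistorParamLeft E j hj p (fderiv ℝ (twistorParam E j hj) p X) = X := by
  rw [fderiv_twistorParam hp]
  exact Prod.ext rfl (fderiv_cayley_fderiv_cayleyInv j hj hp X.2)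

theorem contDiffAt_twistorParamLeft (hp : p ∈ twistorParamDomain E j hj) :
    ContDiffAt ℝ 1 (twistorParamLeft E j hj) p := by
  have h1 : ContDiffAt ℝ 1 (fderiv ℝ (cayley j hj)) (cayleyInv j hj p.2) :=
    (contDiffAt_cayley j hj (isUnit_cayleyInv_add j hj p.2 hp)).fderiv_right (by norm_cast)
  have h2 : ContDiffAt ℝ 1 (fun p : E × TwistorModel F => cayleyInv j hj p.2) p :=
    ((contDiffAt_cayleyInv j hj hp).of_le (by norm_cast)).comp p contDiffAt_snd
  have h3 : ContDiffAt ℝ 1 (fun p : E × TwistorModel F =>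
      fderiv ℝ (cayley j hj) (cayleyInv j hj p.2)) p := h1.comp p h2
  have h4 : ContDiffAt ℝ 1 (fun p : E × TwistorModel F =>
      fderiv ℝ (cayley j hj) (cayleyInv j hj p.2) ∘L ContinuousLinearMap.snd ℝ E (F →L[ℝ] F)) p :=
    h3.clm_comp contDiffAt_const
  -- a form of the definition in which smoothness in `p` is that of compositions
  have h5 : twistorParamLeft E j hj = fun p =>
      ContinuousLinearMap.inl ℝ E (TwistorModel F) ∘L ContinuousLinearMap.fst ℝ E (F →L[ℝ] F) +
      ContinuousLinearMap.inr ℝ E (TwistorModel F) ∘L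
        (fderiv ℝ (cayley j hj) (cayleyInv j hj p.2) ∘L
          ContinuousLinearMap.snd ℝ E (F →L[ℝ] F)) := by
    funext p
    ext X <;> simp [twistorParamLeft]
  rw [h5]
  exact contDiffAt_const.add (contDiffAt_const.clm_comp h4)

theorem fderiv_twistorParam_anticomm (hp : p ∈ twistorParamDomain E j hj)
    (X : E × TwistorModel F) :
    (fderiv ℝ (twistorParam E j hj) p X).2 * (twistorParam E j hj p).2 +
      (twistorParam E j hj p).2 * (fderiv ℝ (twistorParam E j hj) p X).2 = 0 := by
  rw [fderiv_twistorParam hp]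
  exact fderiv_cayleyInv_anticomm j hj hp X.2

theorem twistorParam_sq (hp : p ∈ twistorParamDomain E j hj) :
    (twistorParam E j hj p).2 * (twistorParam E j hj p).2 = -1 :=
  cayleyInv_sq j hj p.2 hp

/-- The almost complex structure of the twistor space in a chart: `modelComplex` transported by the
parametrization. -/
def twistorField (I : E → E →L[ℝ] E) (Γ : E → E →L[ℝ] F →L[ℝ] F) (j : F →L[ℝ] F)
    (hj : j * j = -1) (p : E × TwistorModel F) : E × TwistorModel F →L[ℝ] E × TwistorModel F :=
  twistorParamLeft E j hj p ∘L modelComplex I Γ (twistorParam E j hj p) ∘L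
    fderiv ℝ (twistorParam E j hj) p

variable {I : E → E →L[ℝ] E} {Γ : E → E →L[ℝ] F →L[ℝ] F}

/-- The parametrization intertwines the complex structures: the image of its differential is
invariant. -/
theorem fderiv_twistorParam_twistorField (hp : p ∈ twistorParamDomain E j hj)
    (X : E × TwistorModel F) :
    fderiv ℝ (twistorParam E j hj) p (twistorField I Γ j hj p X) =
      modelComplex I Γ (twistorParam E j hj p) (fderiv ℝ (twistorParam E j hj) p X) := by
  set q := twistorParam E j hj p
  set X' := fderiv ℝ (twistorParam E j hj) p X with hX'
  have h1 : X'.2 * q.2 + q.2 * X'.2 = 0 := fderiv_twistorParam_anticomm hp X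
  have h2 : q.2 * q.2 = -1 := twistorParam_sq hp
  -- `b ↦ a b` and commutators with `a` preserve `{b | b a + a b = 0}`
  have h3 : (modelComplex I Γ q X').2 * q.2 + q.2 * (modelComplex I Γ q X').2 = 0 := by
    have ha (z : F →L[ℝ] F) : q.2 * (q.2 * z) = -z := by rw [← mul_assoc, h2, neg_one_mul]
    have hb : X'.2 * q.2 = -(q.2 * X'.2) := eq_neg_of_add_eq_zero_left h1
    rw [modelComplex_apply]
    simp only [mul_add, add_mul, mul_sub, sub_mul, mul_assoc, ha, hb, h2, mul_neg, mul_one,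
      neg_mul]
    abel
  obtain ⟨a, ha⟩ := exists_fderiv_cayleyInv_eq j hj hp h3
  have h4 : fderiv ℝ (twistorParam E j hj) p ((modelComplex I Γ q X').1, a) =
      modelComplex I Γ q X' := by
    rw [fderiv_twistorParam hp]
    exact Prod.ext rfl ha
  have h5 : twistorField I Γ j hj p X = ((modelComplex I Γ q X').1, a) := by
    change twistorParamLeft E j hj p (modelComplex I Γ q X') = _
    rw [← h4, twistorParamLeft_fderiv hp, h4]
  rw [h5, h4]

theorem contDiffAt_twistorField (hp : p ∈ twistorParamDomain E j hj) (hI : ContDiffAt ℝ 1 I p.1)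
    (hΓ : ContDiffAt ℝ 1 Γ p.1) : ContDiffAt ℝ 1 (twistorField I Γ j hj) p := by
  have h1 : ContDiffAt ℝ 1 (fun p => modelComplex I Γ (twistorParam E j hj p)) p :=
    ContDiffAt.comp p (g := modelComplex I Γ) (contDiffAt_modelComplex hI hΓ)
      ((contDiffAt_twistorParam hp).of_le (by norm_cast))
  have h2 : ContDiffAt ℝ 1 (fderiv ℝ (twistorParam E j hj)) p :=
    (contDiffAt_twistorParam hp).fderiv_right (by norm_cast)
  exact (contDiffAt_twistorParamLeft hp).clm_comp (h1.clm_comp h2)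

end TwistorModelMap

/-! ### Fields of endomorphisms of the tangent bundle in a chart -/

section FieldCoord

variable {E : Type*} [NormedAddCommGroup E] [NormedSpace ℝ E] [FiniteDimensional ℝ E]
  {M : Type*} [TopologicalSpace M] [ChartedSpace E M] [IsManifold 𝓘(ℝ, E) ∞ M]

/-- A field of endomorphisms of the tangent spaces in the preferred chart at `x₀`. -/
def fieldCoord (I : ∀ x : M, TangentSpace 𝓘(ℝ, E) x →L[ℝ] TangentSpace 𝓘(ℝ, E) x) (x₀ : M)
    (p : E) : E →L[ℝ] E :=
  endCoord x₀ (⟨(chartAt E x₀).symm p, I _⟩ :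
    EndTotal E (fun x : M => TangentSpace 𝓘(ℝ, E) x))

theorem coord_tangentSpace {x₀ y : M} (hy : y ∈ (chartAt E x₀).source)
    (v : TangentSpace 𝓘(ℝ, E) y) :
    coord E (V := fun x : M => TangentSpace 𝓘(ℝ, E) x) x₀ y v = chartDeriv x₀ y v := by
  rw [← chartDeriv_eq_trivialization hy]
  exact (coord_eq (EB := E) ⟨hy, by simpa using hy⟩ v).symm

theorem chartDeriv_fieldCoord
    (I : ∀ x : M, TangentSpace 𝓘(ℝ, E) x →L[ℝ] TangentSpace 𝓘(ℝ, E) x) {x₀ y : M}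
    (hy : y ∈ (chartAt E x₀).source) (v : TangentSpace 𝓘(ℝ, E) y) :
    chartDeriv x₀ y (I y v) = fieldCoord I x₀ (chartAt E x₀ y) (chartDeriv x₀ y v) := by
  have hy' : y ∈ localDomain E (fun x : M => TangentSpace 𝓘(ℝ, E) x) E x₀ :=
    ⟨hy, by simpa using hy⟩
  rw [fieldCoord, (chartAt E x₀).left_inv hy, ← coord_tangentSpace hy v,
    ← coord_tangentSpace hy (I y v)]
  exact (endCoord_coord (A := (⟨y, I y⟩ : EndTotal E (fun x : M => TangentSpace 𝓘(ℝ, E) x)))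
    hy' v).symm

theorem IsAlmostComplexStructure.contDiffAt_fieldCoord
    {I : ∀ x : M, TangentSpace 𝓘(ℝ, E) x →L[ℝ] TangentSpace 𝓘(ℝ, E) x}
    (hI : IsAlmostComplexStructure I) (x₀ : M) :
    ContDiffAt ℝ ∞ (fieldCoord I x₀) (chartAt E x₀ x₀) := by
  have h1 : ContMDiffAt 𝓘(ℝ, E) 𝓘(ℝ, E) ∞ (chartAt E x₀).symm (chartAt E x₀ x₀) :=
    (contMDiffOn_chart_symm (x := x₀)).contMDiffAt
      ((chartAt E x₀).open_target.mem_nhds (mem_chart_target E x₀))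
  have h2 := hI.smooth x₀
  rw [contMDiffAt_hom_bundle] at h2
  have h3 : ContMDiffAt 𝓘(ℝ, E) 𝓘(ℝ, E →L[ℝ] E) ∞ (fun x => endCoord x₀
    (⟨x, I x⟩ : EndTotal E (fun x : M => TangentSpace 𝓘(ℝ, E) x))) x₀ := h2.2
  rw [← contMDiffAt_iff_contDiffAt]
  refine ContMDiffAt.comp (g := fun x => endCoord x₀
    (⟨x, I x⟩ : EndTotal E (fun x : M => TangentSpace 𝓘(ℝ, E) x))) _ ?_ h1
  rw [(chartAt E x₀).left_inv (mem_chart_source E x₀)]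
  exact h3

end FieldCoord

/-! ### The twistor space in a chart -/

section TwistorChart

variable {EB : Type*} [NormedAddCommGroup EB] [NormedSpace ℝ EB] [FiniteDimensional ℝ EB]
  {M : Type*} [TopologicalSpace M] [T2Space M] [ChartedSpace EB M] [IsManifold 𝓘(ℝ, EB) ∞ M]
  {F : Type*} [NormedAddCommGroup F] [NormedSpace ℝ F] [FiniteDimensional ℝ F]
  {V : M → Type*} [∀ x, AddCommGroup (V x)] [∀ x, Module ℝ (V x)]
  [TopologicalSpace (TotalSpace F V)] [∀ x, TopologicalSpace (V x)]
  [FiberBundle F V] [VectorBundle ℝ F V]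
  [∀ x, IsTopologicalAddGroup (V x)] [∀ x, ContinuousSMul ℝ (V x)]
  [ContMDiffVectorBundle ∞ F V 𝓘(ℝ, EB)]

namespace TwistorSpace

theorem proj_mem_localDomain {J K : TwistorSpace F V} (hK : K ∈ (chart EB J).source) :
    K.proj ∈ localDomain F V EB J.proj := by
  have h : K.toEnd ∈ (endChart (EB := EB) J.toEnd).source := hK.1
  rw [← extChartAt_source (𝓘(ℝ, EB).prod 𝓘(ℝ, F →L[ℝ] F))] at h
  exact mem_extChartAt_source_iff.1 h

theorem chart_mem_twistorParamDomain {J K : TwistorSpace F V} (hK : K ∈ (chart EB J).source) :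
    chart EB J K ∈ twistorParamDomain EB (base EB J) (base_sq J) :=
  ((chart EB J).map_source hK).1

/-- In coordinates the inclusion of the twistor space in the total space of `End V` is the
parametrization. -/
theorem endMap_toEnd {J K : TwistorSpace F V} (hK : K ∈ (chart EB J).source) :
    endMap EB J.proj K.toEnd = twistorParam EB (base EB J) (base_sq J) (chart EB J K) := by
  have h1 : endMap EB J.proj K.toEnd = endChart (EB := EB) J.1 K.1 :=
    (congrFun (extChartAt_eq_endMap (EB := EB) J.toEnd) K.toEnd).symm
  have h2 := cayleyInv_cayley _ (base_sq J) _ ((endChart_sq (EB := EB) J.1 K.1 hK.1).2 K.2) hK.2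
  rw [h1]
  exact Prod.ext rfl h2.symm

/-- The differential of the inclusion of the twistor space in the total space of `End V`, in
coordinates. -/
theorem endDeriv_toEnd {J K : TwistorSpace F V} (hK : K ∈ (chart EB J).source)
    (X : TangentSpace 𝓘(ℝ, EB × TwistorModel F) K) :
    endDeriv J.proj K.toEnd (mfderiv 𝓘(ℝ, EB × TwistorModel F) (𝓘(ℝ, EB).prod 𝓘(ℝ, F →L[ℝ] F))
        (toEnd : TwistorSpace F V → EndTotal F V) K X) =
      fderiv ℝ (twistorParam EB (base EB J) (base_sq J)) (chart EB J K) (chartDeriv J K X) := by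
  have : IsManifold 𝓘(ℝ, EB × TwistorModel F) 1 (TwistorSpace F V) := .of_le (n := ∞) (by simp)
  have h1 : (fun L => endMap EB J.proj (toEnd L)) =ᶠ[𝓝 K]
      fun L => twistorParam EB (base EB J) (base_sq J) (chart EB J L) := by
    filter_upwards [(chart EB J).open_source.mem_nhds hK] with L hL using endMap_toEnd hL
  have h2 := mfderiv_comp_apply K (mdifferentiableAt_endMap (proj_mem_localDomain hK))
    ((contMDiff_toEnd (EB := EB) (F := F) (V := V) K).mdifferentiableAt (by simp)) X
  have hd := ((contDiffAt_twistorParam (chart_mem_twistorParamDomain hK)).differentiableAt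
    (by simp))
  have h3 := mfderiv_comp_apply (I' := 𝓘(ℝ, EB × TwistorModel F)) K hd.mdifferentiableAt
    (mdifferentiableAt_extChartAt (I := 𝓘(ℝ, EB × TwistorModel F)) (x := J) hK) X
  rw [mfderiv_eq_fderiv] at h3
  refine h2.symm.trans (Eq.trans ?_ h3)
  exact congr($(h1.mfderiv_eq (I := 𝓘(ℝ, EB × TwistorModel F)) (I' := 𝓘(ℝ, EB × (F →L[ℝ] F)))) X)

theorem chartDeriv_projDeriv {J K : TwistorSpace F V} (hK : K ∈ (chart EB J).source)
    (X : TangentSpace 𝓘(ℝ, EB × TwistorModel F) K) :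
    chartDeriv J.proj K.proj (projDeriv K X) = (chartDeriv J K X).1 := by
  have : IsManifold 𝓘(ℝ, EB × TwistorModel F) 1 (TwistorSpace F V) := .of_le (n := ∞) (by simp)
  have : IsManifold 𝓘(ℝ, EB) 1 M := .of_le (n := ∞) (by simp)
  have hp : MDifferentiableAt 𝓘(ℝ, EB × TwistorModel F) 𝓘(ℝ, EB)
      (proj : TwistorSpace F V → M) K :=
    ((Bundle.contMDiff_proj (fun x => V x →L[ℝ] V x)).comp
      (contMDiff_toEnd (EB := EB) (F := F) (V := V)) K).mdifferentiableAt (by simp)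
  have h2 := mfderiv_comp_apply K (mdifferentiableAt_extChartAt (I := 𝓘(ℝ, EB))
    (proj_mem_localDomain hK).1) hp X
  have h3 := mfderiv_comp_apply (I' := 𝓘(ℝ, EB × TwistorModel F)) K
    (ContinuousLinearMap.fst ℝ EB (TwistorModel F)).mdifferentiableAt
    (mdifferentiableAt_extChartAt (I := 𝓘(ℝ, EB × TwistorModel F)) (x := J) hK) X
  rw [ContinuousLinearMap.mfderiv_eq] at h3
  exact h2.symm.trans h3

variable (cov : CovariantDerivative 𝓘(ℝ, EB) F V)

/-- The vertical projection of the twistor space in coordinates. -/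
theorem endCoord_verticalProj {J K : TwistorSpace F V} (hK : K ∈ (chart EB J).source)
    (hΓ : ContDiffAt ℝ 1 (connForm cov J.proj) (chartAt EB J.proj K.proj))
    (X : TangentSpace 𝓘(ℝ, EB × TwistorModel F) K) :
    endCoordHom F (proj_mem_localDomain hK) (verticalProj cov K X) =
      modelVert (connForm cov J.proj)
        (twistorParam EB (base EB J) (base_sq J) (chart EB J K))
        (fderiv ℝ (twistorParam EB (base EB J) (base_sq J)) (chart EB J K)
          (chartDeriv J K X)) := by
  have : CompleteSpace EB := FiniteDimensional.complete ℝ EB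
  rw [← endMap_toEnd hK, ← endDeriv_toEnd hK]
  exact endCoord_endVerticalProj cov (proj_mem_localDomain hK) hΓ _

/-- The defining property of the almost complex structure of the twistor space determines it,
and in coordinates it is the restriction of `modelComplex`. -/
theorem chartDeriv_almostComplex
    (I : ∀ x : M, TangentSpace 𝓘(ℝ, EB) x →L[ℝ] TangentSpace 𝓘(ℝ, EB) x)
    {J K : TwistorSpace F V} (hK : K ∈ (chart EB J).source)
    (hΓ : ContDiffAt ℝ 1 (connForm cov J.proj) (chartAt EB J.proj K.proj))
    (X : TangentSpace 𝓘(ℝ, EB × TwistorModel F) K) :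
    chartDeriv J K (almostComplex cov I K X) =
      twistorField (fieldCoord I J.proj) (connForm cov J.proj) (base EB J) (base_sq J)
        (chart EB J K) (chartDeriv J K X) := by
  set p := chart EB J K
  have hpd : p ∈ twistorParamDomain EB (base EB J) (base_sq J) := chart_mem_twistorParamDomain hK
  have hy := proj_mem_localDomain hK
  set q := twistorParam EB (base EB J) (base_sq J) p
  have hq2 : endCoordHom F hy K.toEnd.2 = q.2 := congr(($(endMap_toEnd hK)).2)
  let D : EB × TwistorModel F →L[ℝ] EB × (F →L[ℝ] F) :=
    fderiv ℝ (twistorParam EB (base EB J) (base_sq J)) p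
  have hD1 (Z : EB × TwistorModel F) : (D Z).1 = Z.1 := by
    simp only [D]
    rw [fderiv_twistorParam hpd]
  -- the conditions that define the almost complex structure, in coordinates
  have key (Z : TangentSpace 𝓘(ℝ, EB × TwistorModel F) K) :
      (verticalProj cov K Z = K.toEnd.2 * verticalProj cov K X ∧
        projDeriv K Z = I K.proj (projDeriv K X)) ↔
      D (chartDeriv J K Z) =
        modelComplex (fieldCoord I J.proj) (connForm cov J.proj) q (D (chartDeriv J K X)) := by
    have e1 : verticalProj cov K Z = K.toEnd.2 * verticalProj cov K X ↔
        modelVert (connForm cov J.proj) q (D (chartDeriv J K Z)) =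
          q.2 * modelVert (connForm cov J.proj) q (D (chartDeriv J K X)) := by
      rw [← (endCoordHom_injective hy).eq_iff, map_mul, hq2, endCoord_verticalProj cov hK hΓ,
        endCoord_verticalProj cov hK hΓ]
    have e2 : projDeriv K Z = I K.proj (projDeriv K X) ↔
        (D (chartDeriv J K Z)).1 = fieldCoord I J.proj q.1 (D (chartDeriv J K X)).1 := by
      rw [← (chartDeriv_bijective hy.1).1.eq_iff, chartDeriv_fieldCoord I hy.1,
        chartDeriv_projDeriv hK, chartDeriv_projDeriv hK, hD1, hD1]
      exact Iff.rfl
    rw [e1, e2]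
    refine ⟨fun h => eq_modelComplex h.2 h.1, fun h => ?_⟩
    rw [h, modelVert_modelComplex]
    exact ⟨rfl, congr(($(modelComplex_apply (fieldCoord I J.proj) (connForm cov J.proj) q
      (D (chartDeriv J K X)))).1)⟩
  have hspec := Classical.epsilon_spec (p := fun Z : TangentSpace 𝓘(ℝ, EB × TwistorModel F) K =>
    verticalProj cov K Z = K.toEnd.2 * verticalProj cov K X ∧
      projDeriv K Z = I K.proj (projDeriv K X)) (by
    obtain ⟨Z, hZ⟩ := (chartDeriv_bijective (E := EB × TwistorModel F) hK).2
      (twistorField (fieldCoord I J.proj) (connForm cov J.proj) (base EB J) (base_sq J) p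
        (chartDeriv J K X))
    refine ⟨Z, (key Z).2 ?_⟩
    rw [hZ]
    exact fderiv_twistorParam_twistorField hpd _)
  have h1 := (key _).1 hspec
  have h2 := congrArg (twistorParamLeft EB (base EB J) (base_sq J) p) h1
  exact (twistorParamLeft_fderiv hpd _).symm.trans h2

end TwistorSpace

end TwistorChart

end

theorem mainTheorem3
    {EB : Type*} [NormedAddCommGroup EB] [NormedSpace ℝ EB] [FiniteDimensional ℝ EB]
    {M : Type*} [TopologicalSpace M] [T2Space M] [ChartedSpace EB M] [IsManifold 𝓘(ℝ, EB) ∞ M]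
    {F : Type*} [NormedAddCommGroup F] [NormedSpace ℝ F] [FiniteDimensional ℝ F]
    {V : M → Type*} [∀ x, AddCommGroup (V x)] [∀ x, Module ℝ (V x)]
    [TopologicalSpace (TotalSpace F V)] [∀ x, TopologicalSpace (V x)]
    [∀ x, IsTopologicalAddGroup (V x)] [∀ x, ContinuousSMul ℝ (V x)]
    [FiberBundle F V] [VectorBundle ℝ F V] [ContMDiffVectorBundle ∞ F V 𝓘(ℝ, EB)]
    (cov : CovariantDerivative 𝓘(ℝ, EB) F V) [CovariantDerivative.ContMDiffCovariantDerivative cov ∞]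
    (I : ∀ x : M, TangentSpace 𝓘(ℝ, EB) x →L[ℝ] TangentSpace 𝓘(ℝ, EB) x)
    (hI : IsAlmostComplexStructure I)
    (J : TwistorSpace F V) (X Y : TangentSpace 𝓘(ℝ, EB × TwistorModel F) J)
    (v w : TangentSpace 𝓘(ℝ, EB) J.proj)
    (hv : v = TwistorSpace.projDeriv J X) (hw : w = TwistorSpace.projDeriv J Y) :
    TwistorSpace.projDeriv J (nijenhuis (TwistorSpace.almostComplex cov I) J X Y) =
        nijenhuis (fun x => I x) J.proj v w ∧
      TwistorSpace.verticalProj cov J (nijenhuis (TwistorSpace.almostComplex cov I) J X Y) =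
        ⁅curvature cov J.proj v w - curvature cov J.proj (I J.proj v) (I J.proj w), J.toEnd.2⁆ +
          J.toEnd.2 * ⁅curvature cov J.proj (I J.proj v) w + curvature cov J.proj v (I J.proj w),
            J.toEnd.2⁆ := by
  subst hv hw
  have : CompleteSpace EB := FiniteDimensional.complete ℝ EB
  have : CompleteSpace (EB × TwistorModel F) := FiniteDimensional.complete ℝ _
  have hJ : J ∈ (TwistorSpace.chart EB J).source := TwistorSpace.mem_chart_source J
  have hy := TwistorSpace.proj_mem_localDomain hJ
  -- coordinates: the point `p` of the model, its image `q` in `EB × End F`, and the local forms of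
  -- the connection and of `I`
  let j : F →L[ℝ] F := TwistorSpace.base EB J
  let hj : j * j = -1 := TwistorSpace.base_sq J
  let Γ := connForm cov J.proj
  let Ic := fieldCoord I J.proj
  let p : EB × TwistorModel F := TwistorSpace.chart EB J J
  let q : EB × (F →L[ℝ] F) := twistorParam EB j hj p
  have hp : p ∈ twistorParamDomain EB j hj := TwistorSpace.chart_mem_twistorParamDomain hJ
  have hΓ : ContDiffAt ℝ 1 Γ q.1 := (contDiffAt_connForm cov J.proj).of_le (by norm_cast)
  have hIc : ContDiffAt ℝ 1 Ic q.1 := (hI.contDiffAt_fieldCoord J.proj).of_le (by norm_cast)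
  have hfield : DifferentiableAt ℝ (twistorField Ic Γ j hj) p :=
    (contDiffAt_twistorField hp hIc hΓ).differentiableAt (by simp)
  -- the almost complex structure of the twistor space near `J`, in the chart at `J`
  have hnear : ∀ᶠ K in 𝓝 J, ∀ Z, chartDeriv J K (TwistorSpace.almostComplex cov I K Z) =
      twistorField Ic Γ j hj (TwistorSpace.chart EB J K) (chartDeriv J K Z) := by
    have hcont : ContinuousAt (fun K => (TwistorSpace.chart EB J K).1) J :=
      ((TwistorSpace.chart EB J).continuousAt hJ).fst
    filter_upwards [(TwistorSpace.chart EB J).open_source.mem_nhds hJ,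
      hcont.eventually (hΓ.eventually (by simp))] with K hK hΓK Z
    exact TwistorSpace.chartDeriv_almostComplex cov I hK hΓK Z
  -- its Nijenhuis tensor, computed in the chart and carried to `EB × End F`
  let X' : EB × TwistorModel F := X
  let Y' : EB × TwistorModel F := Y
  let D : EB × TwistorModel F →L[ℝ] EB × (F →L[ℝ] F) := fderiv ℝ (twistorParam EB j hj) p
  have hD1 (Z : EB × TwistorModel F) : (D Z).1 = Z.1 := by
    simp only [D]
    rw [fderiv_twistorParam hp]
  let N : EB × TwistorModel F := nijenhuis (TwistorSpace.almostComplex cov I) J X Y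
  have hN : N = modelNijenhuis (twistorField Ic Γ j hj) p X' Y' :=
    nijenhuis_eq_modelNijenhuis (x₀ := J) hfield hnear X Y
  have hDN : D N = modelNijenhuis (modelComplex Ic Γ) q (D X') (D Y') := by
    rw [hN]
    refine modelNijenhuis_related ((contDiffAt_twistorParam hp).of_le (by norm_cast)) hfield
      ((contDiffAt_modelComplex hIc hΓ).differentiableAt (by simp)) ?_ X' Y'
    filter_upwards [twistorParamDomain_mem_nhds hp] with r hr Z
      using fderiv_twistorParam_twistorField hr Z
  -- the curvature in coordinates
  let R : EB → EB → F →L[ℝ] F := fun u u' => endCoordHom F hy (curvature cov J.proj u u')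
  have hR (u u' : EB) : R u u' = fderiv ℝ Γ q.1 u u' - fderiv ℝ Γ q.1 u' u +
      (Γ q.1 u * Γ q.1 u' - Γ q.1 u' * Γ q.1 u) := by
    ext f
    have h1 := coord_curvature cov J.proj u u' (frame V J.proj f J.proj)
    rw [coord_frame hy] at h1
    exact h1
  -- the two parts of the Nijenhuis tensor on `EB × End F`, and the projections in coordinates
  obtain ⟨h1, h2⟩ := modelNijenhuis_modelComplex hIc hΓ (twistorParam_sq hp)
    (fderiv_twistorParam_anticomm hp X') (fderiv_twistorParam_anticomm hp Y') hR
  have hproj (Z : EB × TwistorModel F) :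
      (TwistorSpace.projDeriv J (Z : TangentSpace 𝓘(ℝ, EB × TwistorModel F) J) : EB) = (D Z).1 := by
    rw [hD1]
    exact (chartDeriv_self (E := EB) J.proj _).symm.trans
      ((TwistorSpace.chartDeriv_projDeriv hJ _).trans (congrArg Prod.fst (chartDeriv_self J Z)))
  have hvert (Z : EB × TwistorModel F) : endCoordHom F hy (TwistorSpace.verticalProj cov J
      (Z : TangentSpace 𝓘(ℝ, EB × TwistorModel F) J)) = modelVert Γ q (D Z) := by
    exact (TwistorSpace.endCoord_verticalProj cov hJ hΓ _).trans
      (congrArg (fun W => modelVert Γ q (D W)) (chartDeriv_self J Z))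
  have hIJ (u : EB) : (I J.proj u : EB) = Ic q.1 u := by
    exact (chartDeriv_self (E := EB) J.proj _).symm.trans
      ((chartDeriv_fieldCoord I hy.1 u).trans (congrArg (Ic q.1) (chartDeriv_self J.proj u)))
  constructor
  · have h3 := nijenhuis_eq_modelNijenhuis (x₀ := J.proj) (K := fun x => I x)
      ((hI.contDiffAt_fieldCoord J.proj).differentiableAt (by simp))
      (by filter_upwards [(chartAt EB J.proj).open_source.mem_nhds hy.1] with y hy v
          using chartDeriv_fieldCoord I hy v)
      (TwistorSpace.projDeriv J X) (TwistorSpace.projDeriv J Y)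
    refine (hproj N).trans (Eq.trans ?_ h3.symm)
    rw [hDN]
    refine h1.trans ?_
    rw [← hproj X', ← hproj Y']
    rfl
  · apply endCoordHom_injective hy
    refine (hvert N).trans ?_
    rw [hDN]
    have hq : q.2 = endCoordHom F hy J.toEnd.2 := congr(($(TwistorSpace.endMap_toEnd hJ)).2).symm
    refine h2.trans ?_
    change ⁅R (D X').1 (D Y').1 - R (Ic q.1 (D X').1) (Ic q.1 (D Y').1), q.2⁆ +
      q.2 * ⁅R (Ic q.1 (D X').1) (D Y').1 + R (D X').1 (Ic q.1 (D Y').1), q.2⁆ = _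
    rw [← hIJ, ← hIJ, ← hproj X', ← hproj Y', hq]
    simp only [Ring.lie_def, map_add, map_sub, map_mul]
    rfl
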